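/- Let $d\ge 1$, and for $n\ge 1$ let $V_n=\mathbb{Z}^d\cap[1,n]^d$. Let $(g_x)_{x\in V_n}$ be independent standard Gaussian random variables (the disorder), and write $\mathbb{E}$ for expectation with respect to them. For $\beta,h>0$ the random field Ising model on $V_n$ with free boundary condition is the random (Gibbs) probability measure on $\{-1,1\}^{V_n}$ that gives $\sigma$ the probability \[ \frac{1}{Z_n(\beta,h)}\exp\Bigl(\beta\sum_{\langle xy\rangle}\sigma_x\sigma_y+h\sum_{x\in V_n}g_x\sigma_x\Bigr), \] where $\langle xy\rangle$ runs over the unordered pairs of nearest neighbors in $V_n$ and $Z_n(\beta,h)$ is the normalizing constant. Let $p(\beta,h)=\lim_{n\to\infty}|V_n|^{-1}\,\mathbb{E}\log Z_n(\beta,h)$ (this limit exists), and let $A$ be the set of all $(\beta,h)\in(0,\infty)^2$ such that $t\mapsto p(\beta,t)$ is not differentiable at $t=h$. Let $k\ge 2$, let $\sigma^1,\dots,\sigma^{k+1}$ be drawn independently from the Gibbs measure given the disorder, let $\langle\cdot\rangle$ denote the average over these replicas, and let $R_{i,j}=|V_n|^{-1}\sum_{x\in V_n}\sigma^i_x\sigma^j_x$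 be the overlaps. Let $f=f\bigl((R_{i,j})_{1\le i,j\le k}\bigr)$ be a function of the overlaps among the first $k$ replicas, with values in $[-1,1]$ and not depending on $n$. Then for every $(\beta,h)\in(0,\infty)^2\setminus A$, \[ \lim_{n\to\infty}\Bigl(\mathbb{E}\langle fR_{1,k+1}\rangle-\frac1k\,\mathbb{E}\langle f\rangle\,\mathbb{E}\langle R_{1,2}\rangle-\frac1k\sum_{i=2}^k\mathbb{E}\langle fR_{1,i}\rangle\Bigr)=0 . \] -/

import Mathlib

namespace RFIM

open MeasureTheory ProbabilityTheory Filter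

/-- The box `V_n = ℤ^d ∩ [1,n]^d`. -/
noncomputable def box (d n : ℕ) : Finset (Fin d → ℤ) :=
  Fintype.piFinset fun _ => Finset.Icc (1 : ℤ) n

/-- Nearest neighbours in `ℤ^d`: the `ℓ¹`-distance is one. -/
abbrev Neighbors {d : ℕ} (x y : Fin d → ℤ) : Prop :=
  ∑ i, |x i - y i| = 1

/-- Spin configurations on `V_n`; the units of `ℤ` are exactly `1` and `-1`. -/
abbrev Config (d n : ℕ) : Type := box d n → ℤˣ

/-- The real number `σ_x ∈ {-1, 1}`. -/
def spin {d n : ℕ} (σ : Config d n) (x : box d n) : ℝ := ((σ x : ℤ) : ℝ)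

/-- A realization of the disorder `(g_x)` on `V_n`. -/
abbrev Disorder (d n : ℕ) : Type := box d n → ℝ

/-- The law of the disorder: independent standard Gaussians. -/
noncomputable def disorderLaw (d n : ℕ) : Measure (Disorder d n) :=
  Measure.pi fun _ => gaussianReal 0 1

/-- The exponent `β ∑_{⟨xy⟩} σ_x σ_y + h ∑_x g_x σ_x`, with free boundary condition. Every
unordered pair of neighbours counts once, whence the factor `1/2` before the sum over ordered
pairs. -/
noncomputable def exponent {d n : ℕ} (β h : ℝ) (g : Disorder d n) (σ : Config d n) : ℝ :=
  β * ((1 / 2 : ℝ) * ∑ x : box d n, ∑ y : box d n,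
      if Neighbors (x : Fin d → ℤ) y then spin σ x * spin σ y else 0)
    + h * ∑ x : box d n, g x * spin σ x

/-- The partition function `Z_n(β,h)`. -/
noncomputable def partitionFunction {d n : ℕ} (β h : ℝ) (g : Disorder d n) : ℝ :=
  ∑ σ : Config d n, Real.exp (exponent β h g σ)

/-- `ψ_n(β,h) = |V_n|⁻¹ log Z_n(β,h)`. -/
noncomputable def freeEnergyDensity {d n : ℕ} (β h : ℝ) (g : Disorder d n) : ℝ :=
  Real.log (partitionFunction β h g) / ((box d n).card : ℝ)

/-- `p_n(β,h) = 𝔼 ψ_n(β,h)`. -/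
noncomputable def meanFreeEnergy (d n : ℕ) (β h : ℝ) : ℝ :=
  ∫ g, freeEnergyDensity β h g ∂(disorderLaw d n)

/-- `p(β,h) = lim_{n → ∞} p_n(β,h)`. -/
noncomputable def limitFreeEnergy (d : ℕ) (β h : ℝ) : ℝ :=
  limUnder atTop fun n : ℕ => meanFreeEnergy d n β h

/-- The set `A` of all `(β,h) ∈ (0,∞)²` at which `p` is not differentiable in `h`. -/
def exceptionalSet (d : ℕ) : Set (ℝ × ℝ) :=
  {q | 0 < q.1 ∧ 0 < q.2 ∧ ¬ DifferentiableAt ℝ (fun t => limitFreeEnergy d q.1 t) q.2}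

/-- The Gibbs probability of the configuration `σ`. -/
noncomputable def gibbsWeight {d n : ℕ} (β h : ℝ) (g : Disorder d n) (σ : Config d n) : ℝ :=
  Real.exp (exponent β h g σ) / partitionFunction β h g

/-- The average `⟨F⟩` over `m` replicas drawn independently from the Gibbs measure. -/
noncomputable def gibbsAvg {d n m : ℕ} (β h : ℝ) (g : Disorder d n)
    (F : (Fin m → Config d n) → ℝ) : ℝ :=
  ∑ s : Fin m → Config d n, (∏ i, gibbsWeight β h g (s i)) * F s

/-- The quenched average `𝔼⟨F⟩` over `m` replicas. -/
noncomputable def quenchedAvg {d n m : ℕ} (β h : ℝ) (F : (Fin m → Config d n) → ℝ) : ℝ :=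
  ∫ g, gibbsAvg β h g F ∂(disorderLaw d n)

/-- The overlap `|V_n|⁻¹ ∑_x σ_x τ_x`. -/
noncomputable def overlap {d n : ℕ} (σ τ : Config d n) : ℝ :=
  (∑ x : box d n, spin σ x * spin τ x) / ((box d n).card : ℝ)

/-- The array `(R_{i,j})` of the overlaps of the first `k` among `k + 1` replicas. -/
noncomputable def overlaps {d n k : ℕ} (s : Fin (k + 1) → Config d n) : Fin k → Fin k → ℝ :=
  fun i j => overlap (s i.castSucc) (s j.castSucc)

end RFIM

namespace RFIM

open MeasureTheory ProbabilityTheory Filter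

/-! ### Standard Gaussian vectors -/

/-! These are the Ghirlanda–Guerra identities. They follow from computing the quenched average of
`f` times the field density `H(σ) = N⁻¹ ∑ g_x σ_x`, `N = n ^ d`, in two ways.

Gaussian integration by parts (`integral_gibbsAvg_mul_fieldDensity`) gives `𝔼⟨f H(σ¹)⟩ = h (∑_{i ≤
k} 𝔼⟨f R_{1,i}⟩ - k 𝔼⟨f R_{1,k+1}⟩)` with `R_{1,1} = 1`, and for `f = 1` with a single replica,
`𝔼⟨H⟩ = h (1 - 𝔼⟨R_{1,2}⟩)`. If `𝔼⟨|H - q|⟩ → 0` for a constant `q`, then `𝔼⟨f H⟩` is close to `q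
𝔼⟨f⟩` and `𝔼⟨H⟩` to `q`; eliminating `q` yields the claim.

The concentration (`tendsto_integral_sum_gibbsWeight_mul_abs`) holds with `q = ∂p/∂h`. Shifting `h`
by `t` tilts the Gibbs measure by `exp (t N H)`, so the exponential moments of `H - q` are governed
by difference quotients of `ψ_n` at `h`. Jensen's inequality then bounds `⟨|H - q|⟩` by `log 2 / (δ
N)` plus the errors of the quotients at `±δ` (`sum_gibbsWeight_mul_abs_le`), which treats thermal
and disorder fluctuations at once and needs no convexity of `p`. The quotient errors are small
because `ψ_n` concentrates at its mean (`variance_stdGaussianPi_le`), the mean converges to `p`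
(`tendsto_meanFreeEnergy`), and `p` is differentiable at `h`.

Convergence of the mean comes from cutting a box of side `mn` into blocks of side `n`: removing the
edges between blocks changes the free energy density by at most `|β| d / n`. -/

theorem _root_.MeasureTheory.MeasurePreserving.integral_eq {X Y : Type*} [MeasurableSpace X]
    [MeasurableSpace Y] {μ : Measure X} {ν : Measure Y} {φ : X → Y} (hφ : MeasurePreserving φ μ ν)
    {F : Y → ℝ} (hF : AEStronglyMeasurable F ν) : ∫ y, F y ∂ν = ∫ x, F (φ x) ∂μ := by
  have h := integral_map (f := F) hφ.measurable.aemeasurable (by rwa [hφ.map_eq])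
  rwa [hφ.map_eq] at h

/-- The law of a family of independent standard Gaussians. -/
noncomputable abbrev stdGaussianPi (V : Type*) [Fintype V] : Measure (V → ℝ) :=
  Measure.pi fun _ => gaussianReal 0 1

theorem measurePreserving_eval_stdGaussianPi {V : Type*} [Fintype V] (x : V) :
    MeasurePreserving (fun g : V → ℝ => g x) (stdGaussianPi V) (gaussianReal 0 1) :=
  measurePreserving_eval (fun _ : V => gaussianReal 0 1) x

theorem measurePreserving_comp_stdGaussianPi {V W : Type*} [Fintype V] [Fintype W]
    (e : W → V) (he : Function.Injective e) :
    MeasurePreserving (fun (g : V → ℝ) w => g (e w)) (stdGaussianPi V) (stdGaussianPi W) := by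
  refine ⟨by fun_prop, ?_⟩
  have hind : iIndepFun (fun (v : V) (g : V → ℝ) => g v) (stdGaussianPi V) :=
    iIndepFun_pi (X := fun (_ : V) (t : ℝ) => t) (fun _ => aemeasurable_id)
  have h := (iIndepFun_iff_map_fun_eq_pi_map
    (fun w => (measurable_pi_apply (e w)).aemeasurable)).1 (hind.precomp he)
  refine h.trans ?_
  congr 1
  funext w
  exact (measurePreserving_eval_stdGaussianPi (e w)).map_eq

/-- Resampling one coordinate leaves a product law unchanged. With the other coordinates frozen,
integration by parts reduces to the line. -/
theorem measurePreserving_update_stdGaussianPi {V : Type*} [Fintype V] [DecidableEq V] (x : V) :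
    MeasurePreserving (fun p : (V → ℝ) × ℝ => Function.update p.1 x p.2)
      ((stdGaussianPi V).prod (gaussianReal 0 1)) (stdGaussianPi V) := by
  have hm : Measurable (fun p : (V → ℝ) × ℝ => Function.update p.1 x p.2) := by
    refine measurable_pi_lambda _ fun v => ?_
    by_cases hv : v = x
    · subst hv; simpa using measurable_snd
    · simpa [hv, Function.comp_def] using (measurable_pi_apply v).comp measurable_fst
  refine ⟨hm, (Measure.pi_eq fun s hs => ?_).symm⟩
  rw [Measure.map_apply hm (MeasurableSet.univ_pi hs)]
  have hpre : (fun p : (V → ℝ) × ℝ => Function.update p.1 x p.2) ⁻¹' Set.univ.pi s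
      = (Set.univ.pi (Function.update s x Set.univ)) ×ˢ s x := by
    ext p
    simp only [Set.mem_preimage, Set.mem_pi, Set.mem_univ, true_imp_iff, Set.mem_prod]
    constructor
    · intro h
      refine ⟨fun v => ?_, by simpa using h x⟩
      by_cases hv : v = x
      · subst hv; simp
      · simpa [hv] using h v
    · rintro ⟨h1, h2⟩ v
      by_cases hv : v = x
      · subst hv; simpa using h2
      · simpa [hv] using h1 v
  rw [hpre, Measure.prod_prod, Measure.pi_pi, ← Finset.prod_erase_mul _ _ (Finset.mem_univ x),
    ← Finset.prod_erase_mul (a := x) _ (fun i => gaussianReal 0 1 (s i)) (Finset.mem_univ x)]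
  simp only [Function.update_self, measure_univ, mul_one]
  congr 1
  refine Finset.prod_congr rfl fun v hv => ?_
  rw [Function.update_of_ne (Finset.ne_of_mem_erase hv)]

theorem memLp_eval_stdGaussianPi {V : Type*} [Fintype V] (x : V) :
    MemLp (fun g : V → ℝ => g x) 2 (stdGaussianPi V) :=
  (memLp_id_gaussianReal' 2 (by simp)).comp_measurePreserving
    (measurePreserving_eval_stdGaussianPi x)

theorem integrable_eval_stdGaussianPi {V : Type*} [Fintype V] (x : V) :
    Integrable (fun g : V → ℝ => g x) (stdGaussianPi V) :=
  (memLp_eval_stdGaussianPi x).integrable (by norm_num)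

/-- Gaussian integration by parts on the line. -/
theorem integral_id_mul_gaussianReal {F F' : ℝ → ℝ} {C C' : ℝ}
    (hF : ∀ t, HasDerivAt F (F' t) t) (hC : ∀ t, |F t| ≤ C) (hC' : ∀ t, |F' t| ≤ C') :
    ∫ t, t * F t ∂(gaussianReal 0 1) = ∫ t, F' t ∂(gaussianReal 0 1) := by
  have hFc : Continuous F := continuous_iff_continuousAt.2 fun t => (hF t).continuousAt
  have hF'm : Measurable F' := by
    have : F' = deriv F := funext fun t => (hF t).deriv.symm
    rw [this]; exact measurable_deriv F
  set φ : ℝ → ℝ := gaussianPDFReal 0 1 with hφ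
  have hφd : ∀ t, HasDerivAt φ (-t * φ t) t := by
    intro t
    have : φ = fun t => (√(2 * Real.pi * (1 : NNReal)))⁻¹
        * Real.exp (-(t - 0) ^ 2 / (2 * (1 : NNReal))) := rfl
    rw [this]
    have h1 : HasDerivAt (fun t : ℝ => -(t - 0) ^ 2 / (2 * ((1 : NNReal) : ℝ))) (-t) t := by
      have := (((hasDerivAt_id t).sub_const 0).pow 2).neg.div_const (2 * ((1 : NNReal) : ℝ))
      convert! this using 1
      simp
      ring
    convert! (h1.exp.const_mul (√(2 * Real.pi * ((1 : NNReal) : ℝ)))⁻¹) using 1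
    ring
  have hint : Integrable φ := integrable_gaussianPDFReal 0 1
  have hintid : Integrable (fun t => t * φ t) := by
    have h := (memLp_id_gaussianReal' (μ := 0) (v := 1) 1 (by simp)).integrable le_rfl
    rw [gaussianReal_of_var_ne_zero 0 one_ne_zero,
      integrable_withDensity_iff (measurable_gaussianPDF 0 1)
        (ae_of_all _ fun _ => gaussianPDF_lt_top)] at h
    simpa [toReal_gaussianPDF] using h
  have hA : Integrable (fun t => F t * (t * φ t)) :=
    hintid.bdd_mul hFc.aestronglyMeasurable (ae_of_all _ hC)
  have hB : Integrable (fun t => F' t * φ t) :=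
    hint.bdd_mul hF'm.aestronglyMeasurable (ae_of_all _ hC')
  have hD : Integrable (fun t => F t * φ t) :=
    hint.bdd_mul hFc.aestronglyMeasurable (ae_of_all _ hC)
  -- The density satisfies `φ' = -t φ`, so the vanishing integral of `(F φ)'` is the desired
  -- identity.
  have key := integral_eq_zero_of_hasDerivAt_of_integrable
    (f := fun t => F t * φ t) (f' := fun t => F' t * φ t + F t * (-t * φ t))
    (fun t => (hF t).mul (hφd t))
    (by
      have := hB.sub hA
      refine this.congr (ae_of_all _ fun t => ?_)
      simp; ring) hD
  rw [integral_gaussianReal_eq_integral_smul one_ne_zero,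
    integral_gaussianReal_eq_integral_smul one_ne_zero]
  have h2 : ∫ t, (F' t * φ t + F t * (-t * φ t)) = (∫ t, F' t * φ t) - ∫ t, F t * (t * φ t) := by
    rw [← integral_sub hB hA]
    congr 1; funext t; ring
  rw [h2] at key
  simp only [smul_eq_mul]
  have e1 : (fun t => gaussianPDFReal 0 1 t * (t * F t)) = fun t => F t * (t * φ t) := by
    funext t; simp only [hφ]; ring
  have e2 : (fun t => gaussianPDFReal 0 1 t * F' t) = fun t => F' t * φ t := by
    funext t; simp only [hφ]; ring
  rw [e1, e2]; linarith

/-- Gaussian integration by parts in one coordinate. -/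
theorem integral_eval_mul_stdGaussianPi {V : Type*} [Fintype V] [DecidableEq V] (x : V)
    {F F' : (V → ℝ) → ℝ} {C C' : ℝ} (hFc : Continuous F) (hF'c : Continuous F')
    (hF : ∀ g t, HasDerivAt (fun t => F (Function.update g x t)) (F' (Function.update g x t)) t)
    (hC : ∀ g, |F g| ≤ C) (hC' : ∀ g, |F' g| ≤ C') :
    ∫ g, g x * F g ∂(stdGaussianPi V) = ∫ g, F' g ∂(stdGaussianPi V) := by
  have hmp := measurePreserving_update_stdGaussianPi x
  have hi1 : Integrable (fun g : V → ℝ => g x * F g) (stdGaussianPi V) :=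
    (integrable_eval_stdGaussianPi x).mul_bdd hFc.aestronglyMeasurable (ae_of_all _ hC)
  have hi2 : Integrable F' (stdGaussianPi V) :=
    Integrable.of_bound hF'c.aestronglyMeasurable C' (ae_of_all _ hC')
  have e1 : ∫ g, g x * F g ∂(stdGaussianPi V) = ∫ p, p.2 * F (Function.update p.1 x p.2)
      ∂((stdGaussianPi V).prod (gaussianReal 0 1)) := by
    rw [hmp.integral_eq hi1.aestronglyMeasurable]
    simp
  have e2 : ∫ g, F' g ∂(stdGaussianPi V) = ∫ p, F' (Function.update p.1 x p.2)
      ∂((stdGaussianPi V).prod (gaussianReal 0 1)) :=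
    hmp.integral_eq hi2.aestronglyMeasurable
  have hj1 : Integrable (fun p : (V → ℝ) × ℝ => p.2 * F (Function.update p.1 x p.2))
      ((stdGaussianPi V).prod (gaussianReal 0 1)) := by
    simpa [Function.comp_def] using hmp.integrable_comp_of_integrable hi1
  have hj2 : Integrable (fun p : (V → ℝ) × ℝ => F' (Function.update p.1 x p.2))
      ((stdGaussianPi V).prod (gaussianReal 0 1)) := hmp.integrable_comp_of_integrable hi2
  rw [e1, e2, integral_prod _ hj1, integral_prod _ hj2]
  congr 1; funext g
  exact integral_id_mul_gaussianReal (hF g) (fun _ => hC _) (fun _ => hC' _)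

/-! ### Variance of Lipschitz functions -/

theorem memLp_of_abs_sub_le {V : Type*} [Fintype V] {F : (V → ℝ) → ℝ} {c : ℝ}
    (hFc : Continuous F) (hF : ∀ g g', |F g - F g'| ≤ c * ∑ x, |g x - g' x|) :
    MemLp F 2 (stdGaussianPi V) := by
  have h1 : MemLp (fun g : V → ℝ => |F 0| + c * ∑ x, |g x|) 2 (stdGaussianPi V) := by
    have hs : MemLp (fun g : V → ℝ => ∑ x, |g x|) 2 (stdGaussianPi V) :=
      memLp_finsetSum _ fun x _ => (memLp_eval_stdGaussianPi x).abs
    exact (memLp_const |F 0|).add (hs.const_mul c)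
  refine h1.mono hFc.aestronglyMeasurable (ae_of_all _ fun g => ?_)
  have h2 := hF g 0
  simp only [Pi.zero_apply, sub_zero] at h2
  have h3 := abs_sub_abs_le_abs_sub (F g) (F 0)
  rw [Real.norm_eq_abs, Real.norm_eq_abs]
  exact le_trans (by linarith) (le_abs_self _)

/-- The variance is at most the second moment about any point; about `G 0` the latter is at most `c
^ 2` times the second moment of a standard Gaussian. -/
theorem variance_gaussianReal_le {G : ℝ → ℝ} {c : ℝ} (hGc : Continuous G)
    (hG : ∀ t t', |G t - G t'| ≤ c * |t - t'|) : Var[G; gaussianReal 0 1] ≤ c ^ 2 := by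
  have hid : MemLp (fun t : ℝ => t) 2 (gaussianReal 0 1) := memLp_id_gaussianReal' 2 (by simp)
  have hsq : ∫ t, t ^ 2 ∂(gaussianReal 0 1) = 1 := by
    have h := variance_fun_id_gaussianReal (μ := 0) (v := 1)
    rw [variance_eq_sub hid] at h
    simpa [integral_id_gaussianReal] using h
  have hle : ∀ t, (G t - G 0) ^ 2 ≤ c ^ 2 * t ^ 2 := by
    intro t
    have h := hG t 0
    rw [sub_zero] at h
    calc (G t - G 0) ^ 2 = |G t - G 0| ^ 2 := (sq_abs _).symm
      _ ≤ (c * |t|) ^ 2 := by gcongr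
      _ = c ^ 2 * t ^ 2 := by rw [mul_pow, sq_abs]
  rw [← variance_sub_const hGc.aestronglyMeasurable (G 0)]
  refine (variance_le_expectation_sq (by fun_prop)).trans ?_
  have hi : Integrable (fun t : ℝ => c ^ 2 * t ^ 2) (gaussianReal 0 1) :=
    hid.integrable_sq.const_mul _
  calc ∫ t, (G t - G 0) ^ 2 ∂(gaussianReal 0 1)
      ≤ ∫ t, c ^ 2 * t ^ 2 ∂(gaussianReal 0 1) :=
        integral_mono_of_nonneg (ae_of_all _ fun t => sq_nonneg _) hi (ae_of_all _ hle)
    _ = c ^ 2 := by rw [integral_const_mul, hsq, mul_one]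

theorem continuous_of_abs_sub_le {V : Type*} [Fintype V] {F : (V → ℝ) → ℝ} {c : ℝ}
    (hF : ∀ g g', |F g - F g'| ≤ c * ∑ x, |g x - g' x|) : Continuous F := by
  refine continuous_iff_continuousAt.2 fun g₀ => tendsto_iff_dist_tendsto_zero.2 ?_
  have h : Continuous fun g : V → ℝ => c * ∑ x, |g x - g₀ x| := by fun_prop
  have h0 := h.tendsto g₀
  simp only [sub_self, abs_zero, Finset.sum_const_zero, mul_zero] at h0
  exact squeeze_zero (fun _ => dist_nonneg) (fun g => hF g g₀) h0

/-- Induction by the law of total variance. Given the first coordinate, the variance is at most `m *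
c ^ 2`; the conditional mean `G` inherits the Lipschitz constant `c` and adds at most `c ^ 2`. -/
theorem variance_fin_stdGaussianPi_le (m : ℕ) {F : (Fin m → ℝ) → ℝ} {c : ℝ}
    (hF : ∀ g g', |F g - F g'| ≤ c * ∑ x, |g x - g' x|) :
    Var[F; stdGaussianPi (Fin m)] ≤ m * c ^ 2 := by
  induction m with
  | zero =>
    have : F = fun _ => F 0 := funext fun g => congrArg F (Subsingleton.elim _ _)
    rw [this, variance_eq_sub (memLp_const _)]
    simp
  | succ m ih =>
    have hFc := continuous_of_abs_sub_le hF
    have hL := memLp_of_abs_sub_le hFc hF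
    have hmp : MeasurePreserving (fun p : ℝ × (Fin m → ℝ) => (Fin.cons p.1 p.2 : Fin (m + 1) → ℝ))
        ((gaussianReal 0 1).prod (stdGaussianPi (Fin m))) (stdGaussianPi (Fin (m + 1))) := by
      have := (measurePreserving_piFinSuccAbove (fun _ : Fin (m + 1) => gaussianReal 0 1) 0).symm
      have heq : (fun p : ℝ × (Fin m → ℝ) => (Fin.cons p.1 p.2 : Fin (m + 1) → ℝ))
          = (MeasurableEquiv.piFinSuccAbove (fun _ : Fin (m + 1) => ℝ) 0).symm := by
        funext p i
        refine Fin.cases ?_ (fun j => ?_) i <;> simp [MeasurableEquiv.piFinSuccAbove]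
      rw [heq]
      exact this
    set G : ℝ → ℝ := fun t => ∫ g, F (Fin.cons t g) ∂(stdGaussianPi (Fin m)) with hGdef
    have hsec : ∀ t, ∀ g g', |F (Fin.cons t g) - F (Fin.cons t g')| ≤ c * ∑ x, |g x - g' x| := by
      intro t g g'
      simpa [Fin.sum_univ_succ] using hF (Fin.cons t g) (Fin.cons t g')
    have hsecL : ∀ t, MemLp (fun g => F (Fin.cons t g)) 2 (stdGaussianPi (Fin m)) := fun t =>
      memLp_of_abs_sub_le (continuous_of_abs_sub_le (hsec t)) (hsec t)
    have hGlip : ∀ t t', |G t - G t'| ≤ c * |t - t'| := by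
      intro t t'
      rw [hGdef]
      simp only
      rw [← integral_sub ((hsecL t).integrable (by norm_num)) ((hsecL t').integrable (by norm_num))]
      have : ∀ g, ‖F (Fin.cons t g) - F (Fin.cons t' g)‖ ≤ c * |t - t'| := fun g => by
        simpa [Fin.sum_univ_succ] using hF (Fin.cons t g) (Fin.cons t' g)
      simpa using norm_integral_le_of_norm_le_const (μ := stdGaussianPi (Fin m)) (ae_of_all _ this)
    have hGc : Continuous G := by
      refine continuous_iff_continuousAt.2 fun t₀ => tendsto_iff_dist_tendsto_zero.2 ?_
      have h : Continuous fun t : ℝ => c * |t - t₀| := by fun_prop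
      have h0 := h.tendsto t₀
      simp only [sub_self, abs_zero, mul_zero] at h0
      exact squeeze_zero (fun _ => dist_nonneg) (fun t => hGlip t t₀) h0
    have hGvar := variance_gaussianReal_le hGc hGlip
    have hLp := hL.comp_measurePreserving hmp
    have hGL : MemLp G 2 (gaussianReal 0 1) := by
      have h1 : MemLp (fun t : ℝ => |G 0| + c * |t|) 2 (gaussianReal 0 1) :=
        (memLp_const |G 0|).add (MemLp.const_mul
          (MemLp.abs (f := fun t : ℝ => t) (memLp_id_gaussianReal' 2 (by simp))) c)
      refine h1.mono hGc.aestronglyMeasurable (ae_of_all _ fun t => ?_)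
      have h2 := hGlip t 0
      rw [sub_zero] at h2
      have h3 := abs_sub_abs_le_abs_sub (G t) (G 0)
      rw [Real.norm_eq_abs, Real.norm_eq_abs]
      exact le_trans (by linarith) (le_abs_self _)
    have hI1 : ∫ g, F g ∂(stdGaussianPi (Fin (m + 1))) = ∫ t, G t ∂(gaussianReal 0 1) := by
      rw [hmp.integral_eq hFc.aestronglyMeasurable]
      exact integral_prod _ (hLp.integrable (by norm_num))
    have hI2 : ∫ g, F g ^ 2 ∂(stdGaussianPi (Fin (m + 1)))
        = ∫ t, ∫ g, F (Fin.cons t g) ^ 2 ∂(stdGaussianPi (Fin m)) ∂(gaussianReal 0 1) := by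
      rw [hmp.integral_eq (F := fun g => F g ^ 2) (hFc.pow 2).aestronglyMeasurable]
      exact integral_prod _ hLp.integrable_sq
    have hcond : ∀ t, ∫ g, F (Fin.cons t g) ^ 2 ∂(stdGaussianPi (Fin m)) - G t ^ 2 ≤ m * c ^ 2 := by
      intro t
      have h := ih (hsec t)
      rwa [variance_eq_sub (hsecL t)] at h
    have hint : Integrable (fun t => ∫ g, F (Fin.cons t g) ^ 2 ∂(stdGaussianPi (Fin m)))
        (gaussianReal 0 1) := hLp.integrable_sq.integral_prod_left
    have hle := integral_mono (hint.sub hGL.integrable_sq)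
      (integrable_const (μ := gaussianReal 0 1) ((m : ℝ) * c ^ 2)) hcond
    simp only [Pi.sub_apply] at hle
    rw [integral_sub hint hGL.integrable_sq] at hle
    simp only [integral_const, probReal_univ, one_smul] at hle
    rw [variance_eq_sub hGL] at hGvar
    rw [variance_eq_sub hL]
    simp only [Pi.pow_apply] at hGvar ⊢
    rw [hI1, hI2]
    push_cast
    linarith

/-- The Efron–Stein bound for a function that is Lipschitz in each of the coordinates. -/
theorem variance_stdGaussianPi_le {V : Type*} [Fintype V] {F : (V → ℝ) → ℝ} {c : ℝ}
    (hF : ∀ g g', |F g - F g'| ≤ c * ∑ x, |g x - g' x|) :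
    Var[F; stdGaussianPi V] ≤ Fintype.card V * c ^ 2 := by
  let e := Fintype.equivFin V
  have hmp := measurePreserving_comp_stdGaussianPi e e.injective
  have hFc := continuous_of_abs_sub_le hF
  have h := variance_fin_stdGaussianPi_le (Fintype.card V)
    (F := fun g => F fun v => g (e v)) (c := c) fun g g' => by
      refine (hF _ _).trans_eq ?_
      rw [← e.sum_comp]
  rw [← hmp.map_eq, variance_map hFc.aemeasurable hmp.measurable.aemeasurable]
  exact h

/-! ### Ising models with general couplings -/

theorem log_sum_exp_le_add {S : Type*} [Fintype S] [Nonempty S] {E E' : S → ℝ} {c : ℝ}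
    (h : ∀ s, E s ≤ E' s + c) :
    Real.log (∑ s, Real.exp (E s)) ≤ Real.log (∑ s, Real.exp (E' s)) + c := by
  have hpos : 0 < ∑ s, Real.exp (E' s) :=
    Finset.sum_pos (fun s _ => Real.exp_pos _) Finset.univ_nonempty
  rw [← Real.log_exp c, ← Real.log_mul hpos.ne' (Real.exp_pos _).ne', Finset.sum_mul]
  refine Real.log_le_log (Finset.sum_pos (fun s _ => Real.exp_pos _) Finset.univ_nonempty)
    (Finset.sum_le_sum fun s _ => ?_)
  rw [← Real.exp_add]
  simpa using h s

/-- This sup-norm stability of the log-partition function serves twice: for the Lipschitz dependence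
on the disorder and for the cost of deleting edges. -/
theorem abs_log_sum_exp_sub_le {S : Type*} [Fintype S] [Nonempty S] {E E' : S → ℝ} {c : ℝ}
    (h : ∀ s, |E s - E' s| ≤ c) :
    |Real.log (∑ s, Real.exp (E s)) - Real.log (∑ s, Real.exp (E' s))| ≤ c := by
  rw [abs_le]
  constructor
  · linarith [log_sum_exp_le_add (E := E') (E' := E) (c := c)
      fun s => by linarith [(abs_le.1 (h s)).1]]
  · linarith [log_sum_exp_le_add (E := E) (E' := E') (c := c)
      fun s => by linarith [(abs_le.1 (h s)).2]]

theorem abs_units_int (u : ℤˣ) : |((u : ℤ) : ℝ)| = 1 := by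
  rcases Int.units_eq_one_or u with h | h <;> simp [h]

section Couplings

variable {V W A B : Type*} [Fintype V] [DecidableEq V] [Fintype W] [DecidableEq W]
  [Fintype A] [DecidableEq A] [Fintype B] [DecidableEq B]

/-- The exponent of the Ising model with couplings `J`, over all ordered pairs of sites, in the
external field `h • g`. -/
noncomputable def energy (J : V → V → ℝ) (h : ℝ) (g : V → ℝ) (σ : V → ℤˣ) : ℝ :=
  ∑ x, ∑ y, J x y * (((σ x : ℤ) : ℝ) * ((σ y : ℤ) : ℝ)) + h * ∑ x, g x * ((σ x : ℤ) : ℝ)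

/-- The logarithm of the partition function of the Ising model with couplings `J`. -/
noncomputable def logZ (J : V → V → ℝ) (h : ℝ) (g : V → ℝ) : ℝ :=
  Real.log (∑ σ : V → ℤˣ, Real.exp (energy J h g σ))

/-- The expectation of `logZ` over a standard Gaussian field. -/
noncomputable def meanLogZ (J : V → V → ℝ) (h : ℝ) : ℝ :=
  ∫ g, logZ J h g ∂(stdGaussianPi V)

theorem abs_logZ_sub_le (J J' : V → V → ℝ) (h : ℝ) (g g' : V → ℝ) :
    |logZ J h g - logZ J' h g'| ≤ ∑ x, ∑ y, |J x y - J' x y| + |h| * ∑ x, |g x - g' x| := by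
  refine abs_log_sum_exp_sub_le fun σ => ?_
  have e : energy J h g σ - energy J' h g' σ
      = ∑ x, ∑ y, (J x y - J' x y) * (((σ x : ℤ) : ℝ) * ((σ y : ℤ) : ℝ))
        + h * ∑ x, (g x - g' x) * ((σ x : ℤ) : ℝ) := by
    simp only [energy, sub_mul, Finset.sum_sub_distrib]
    ring
  rw [e]
  refine (abs_add_le _ _).trans (add_le_add ?_ ?_)
  · refine (Finset.abs_sum_le_sum_abs _ _).trans (Finset.sum_le_sum fun x _ => ?_)
    refine (Finset.abs_sum_le_sum_abs _ _).trans (Finset.sum_le_sum fun y _ => ?_)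
    rw [abs_mul, abs_mul, abs_units_int, abs_units_int, mul_one, mul_one]
  · rw [abs_mul]
    refine mul_le_mul_of_nonneg_left ?_ (abs_nonneg h)
    refine (Finset.abs_sum_le_sum_abs _ _).trans (Finset.sum_le_sum fun x _ => ?_)
    rw [abs_mul, abs_units_int, mul_one]

theorem abs_logZ_sub_le_field (J : V → V → ℝ) (h : ℝ) (g g' : V → ℝ) :
    |logZ J h g - logZ J h g'| ≤ |h| * ∑ x, |g x - g' x| := by
  simpa using abs_logZ_sub_le J J h g g'

theorem continuous_logZ (J : V → V → ℝ) (h : ℝ) : Continuous (logZ J h) :=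
  continuous_of_abs_sub_le (abs_logZ_sub_le_field J h)

theorem memLp_logZ (J : V → V → ℝ) (h : ℝ) : MemLp (logZ J h) 2 (stdGaussianPi V) :=
  memLp_of_abs_sub_le (continuous_logZ J h) (abs_logZ_sub_le_field J h)

theorem integrable_logZ (J : V → V → ℝ) (h : ℝ) : Integrable (logZ J h) (stdGaussianPi V) :=
  (memLp_logZ J h).integrable (by norm_num)

theorem abs_meanLogZ_sub_le (J J' : V → V → ℝ) (h : ℝ) :
    |meanLogZ J h - meanLogZ J' h| ≤ ∑ x, ∑ y, |J x y - J' x y| := by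
  rw [meanLogZ, meanLogZ, ← integral_sub (integrable_logZ J h) (integrable_logZ J' h)]
  have : ∀ g, ‖logZ J h g - logZ J' h g‖ ≤ ∑ x, ∑ y, |J x y - J' x y| := fun g => by
    simpa using abs_logZ_sub_le J J' h g g
  simpa using norm_integral_le_of_norm_le_const (μ := stdGaussianPi V) (ae_of_all _ this)

theorem integral_abs_logZ_sub_le (J : V → V → ℝ) (h : ℝ) :
    ∫ g, |logZ J h g - meanLogZ J h| ∂(stdGaussianPi V) ≤ |h| * √(Fintype.card V) := by
  have hv := variance_stdGaussianPi_le (abs_logZ_sub_le_field J h)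
  have hL := memLp_logZ J h
  have hX : MemLp (fun g => |logZ J h g - meanLogZ J h|) 2 (stdGaussianPi V) :=
    (hL.sub (memLp_const _)).abs
  -- A nonnegative variance of `|X|` means `(𝔼|X|)² ≤ 𝔼 X²`, which turns the variance bound into an
  -- `L¹` bound.
  have h0 : 0 ≤ Var[fun g => |logZ J h g - meanLogZ J h|; stdGaussianPi V] := variance_nonneg _ _
  rw [variance_eq_sub hX] at h0
  rw [variance_eq_integral hL.aemeasurable] at hv
  simp only [Pi.pow_apply, sq_abs] at h0 hv
  change ∫ g, (logZ J h g - meanLogZ J h) ^ 2 ∂_ ≤ _ at hv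
  refine abs_le_of_sq_le_sq' ?_ (by positivity) |>.2
  rw [mul_pow, Real.sq_sqrt (by positivity), sq_abs]
  linarith

theorem logZ_comp_equiv (e : W ≃ V) (J : V → V → ℝ) (h : ℝ) (g : V → ℝ) :
    logZ (fun a b => J (e a) (e b)) h (fun a => g (e a)) = logZ J h g := by
  unfold logZ
  congr 1
  rw [← (e.arrowCongr (Equiv.refl ℤˣ)).sum_comp]
  refine Finset.sum_congr rfl fun σ _ => ?_
  congr 1
  unfold energy
  rw [← e.sum_comp, ← e.sum_comp]
  simp only [Equiv.arrowCongr_apply, Equiv.coe_refl, Function.comp_apply, id_eq,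
    Equiv.symm_apply_apply]
  congr 1
  refine Finset.sum_congr rfl fun a _ => ?_
  rw [← e.sum_comp]
  simp

theorem meanLogZ_comp_equiv (e : W ≃ V) (J : V → V → ℝ) (h : ℝ) :
    meanLogZ (fun a b => J (e a) (e b)) h = meanLogZ J h := by
  unfold meanLogZ
  rw [(measurePreserving_comp_stdGaussianPi e e.injective).integral_eq
    (continuous_logZ _ h).aestronglyMeasurable]
  simp only [logZ_comp_equiv]

/-- Here `A` indexes the blocks and `B` the sites within a block. Without couplings between blocks
the partition function factorizes. -/
theorem logZ_block (J : B → B → ℝ) (h : ℝ) (g : A × B → ℝ) :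
    logZ (fun p q : A × B => if p.1 = q.1 then J p.2 q.2 else 0) h g
      = ∑ a, logZ J h fun b => g (a, b) := by
  unfold logZ
  rw [← Real.log_prod fun a _ =>
    (Finset.sum_pos (fun s _ => Real.exp_pos _) Finset.univ_nonempty).ne']
  congr 1
  rw [Finset.prod_univ_sum, Fintype.piFinset_univ, ← (Equiv.curry A B ℤˣ).sum_comp]
  refine Finset.sum_congr rfl fun σ _ => ?_
  rw [← Real.exp_sum]
  congr 1
  simp only [energy, Equiv.curry_apply, Function.curry_apply, Finset.sum_add_distrib,
    Fintype.sum_prod_type, Finset.mul_sum]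
  congr 1
  refine Finset.sum_congr rfl fun a _ => Finset.sum_congr rfl fun b _ => ?_
  rw [Finset.sum_eq_single a]
  · simp
  · intro a' _ ha'
    simp [Ne.symm ha']
  · simp

theorem meanLogZ_block (J : B → B → ℝ) (h : ℝ) :
    meanLogZ (fun p q : A × B => if p.1 = q.1 then J p.2 q.2 else 0) h
      = Fintype.card A * meanLogZ J h := by
  have hmp : ∀ a : A, MeasurePreserving (fun (g : A × B → ℝ) b => g (a, b))
      (stdGaussianPi (A × B)) (stdGaussianPi B) := fun a =>
    measurePreserving_comp_stdGaussianPi (fun b => (a, b)) fun b b' hb => by simpa using hb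
  unfold meanLogZ
  simp only [logZ_block]
  have hint : ∀ a : A, Integrable (fun g : A × B → ℝ => logZ J h fun b => g (a, b))
      (stdGaussianPi (A × B)) := fun a =>
    (hmp a).integrable_comp_of_integrable (integrable_logZ J h)
  rw [integral_finsetSum _ fun a _ => hint a]
  rw [Finset.sum_congr rfl fun a _ =>
    ((hmp a).integral_eq (continuous_logZ J h).aestronglyMeasurable).symm]
  simp

end Couplings

/-! ### Existence of the limiting free energy -/

/-- The nearest neighbour couplings on `{0, …, n - 1}^d`. -/
noncomputable def gridCoupling (d n : ℕ) (β : ℝ) (x y : Fin d → Fin n) : ℝ :=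
  β * (1 / 2) * if ∑ i, |((x i : ℕ) : ℤ) - ((y i : ℕ) : ℤ)| = 1 then 1 else 0

/-- The nearest neighbour couplings on the box `V_n`. -/
noncomputable def boxCoupling (d n : ℕ) (β : ℝ) (x y : box d n) : ℝ :=
  β * (1 / 2) * if Neighbors (x : Fin d → ℤ) y then 1 else 0

theorem mem_box {d n : ℕ} {x : Fin d → ℤ} : x ∈ box d n ↔ ∀ i, 1 ≤ x i ∧ x i ≤ n := by
  simp [box]

/-- The box `V_n` as a translate of `{0, …, n - 1}^d`. -/
def gridEquivBox (d n : ℕ) : (Fin d → Fin n) ≃ box d n where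
  toFun x := ⟨fun i => (x i : ℕ) + 1, mem_box.2 fun i => by have := (x i).2; omega⟩
  invFun v i := ⟨((v : Fin d → ℤ) i - 1).toNat, by have := mem_box.1 v.2 i; omega⟩
  left_inv x := by ext i; simp
  right_inv v := by
    ext i
    have := mem_box.1 v.2 i
    simp
    omega

theorem boxCoupling_gridEquivBox (d n : ℕ) (β : ℝ) (x y : Fin d → Fin n) :
    boxCoupling d n β (gridEquivBox d n x) (gridEquivBox d n y) = gridCoupling d n β x y := by
  simp [boxCoupling, gridCoupling, gridEquivBox, Neighbors]

theorem exponent_eq_energy {d n : ℕ} (β h : ℝ) (g : Disorder d n) (σ : Config d n) :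
    exponent β h g σ = energy (boxCoupling d n β) h g σ := by
  unfold exponent energy spin boxCoupling
  congr 1
  rw [← mul_assoc, Finset.mul_sum]
  refine Finset.sum_congr rfl fun x _ => ?_
  rw [Finset.mul_sum]
  refine Finset.sum_congr rfl fun y _ => ?_
  split_ifs <;> simp

theorem log_partitionFunction {d n : ℕ} (β h : ℝ) (g : Disorder d n) :
    Real.log (partitionFunction β h g) = logZ (boxCoupling d n β) h g := by
  simp only [partitionFunction, logZ, exponent_eq_energy]

theorem card_box (d n : ℕ) : (box d n).card = n ^ d := by
  simp [box]

theorem meanFreeEnergy_eq (d n : ℕ) (β h : ℝ) :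
    meanFreeEnergy d n β h = meanLogZ (gridCoupling d n β) h / (n : ℝ) ^ d := by
  have e : gridCoupling d n β
      = fun x y => boxCoupling d n β (gridEquivBox d n x) (gridEquivBox d n y) := by
    funext x y
    exact (boxCoupling_gridEquivBox d n β x y).symm
  rw [e, meanLogZ_comp_equiv]
  unfold meanFreeEnergy freeEnergyDensity meanLogZ disorderLaw
  rw [integral_div, card_box]
  simp only [log_partitionFunction, Nat.cast_pow]

/-- Cutting `{0, …, mn - 1}^d` into blocks of side `n`. -/
def blockEquiv (d m n : ℕ) :
    (Fin d → Fin m) × (Fin d → Fin n) ≃ (Fin d → Fin (m * n)) :=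
  (Equiv.arrowProdEquivProdArrow (Fin d) (fun _ => Fin m) (fun _ => Fin n)).symm.trans
    (Equiv.arrowCongr (Equiv.refl _) finProdFinEquiv)

theorem blockEquiv_apply (d m n : ℕ) (p : (Fin d → Fin m) × (Fin d → Fin n)) (i : Fin d) :
    ((blockEquiv d m n p i : Fin (m * n)) : ℕ) = p.2 i + n * p.1 i := by
  simp [blockEquiv]

theorem blockEquiv_div (d m n : ℕ) (p : (Fin d → Fin m) × (Fin d → Fin n)) (i : Fin d) :
    ((blockEquiv d m n p i : Fin (m * n)) : ℕ) / n = p.1 i := by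
  have hn : 0 < n := (Nat.zero_le _).trans_lt (p.2 i).2
  rw [blockEquiv_apply, Nat.add_mul_div_left _ _ hn, Nat.div_eq_of_lt (p.2 i).2, zero_add]

/-- Adjacent pairs of `{0, …, mn - 1}` that lie in different blocks of length `n`. -/
def crossingPairs (m n : ℕ) : Finset (Fin (m * n) × Fin (m * n)) :=
  {p | |((p.1 : ℕ) : ℤ) - ((p.2 : ℕ) : ℤ)| = 1 ∧ (p.1 : ℕ) / n ≠ (p.2 : ℕ) / n}

/-- A crossing pair is determined by its orientation and by the block of its larger element, which
must be the first site of that block. -/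
theorem card_crossingPairs_le (m n : ℕ) : (crossingPairs m n).card ≤ 2 * m := by
  have hlast : ∀ a b : ℕ, b = a + 1 → a / n ≠ b / n → n * (b / n) = b := by
    intro a b hab hne
    refine Nat.mul_div_cancel' ?_
    by_contra hd
    subst hab
    exact hne (by rw [Nat.succ_div, if_neg hd, add_zero])
  have hdiv : ∀ u : Fin (m * n), (u : ℕ) / n < m := fun u =>
    Nat.div_lt_of_lt_mul (u.2.trans_eq (mul_comm m n))
  have h : (crossingPairs m n).card ≤ (Finset.univ : Finset (Bool × Fin m)).card := by
    refine Finset.card_le_card_of_injOn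
      (fun p => if (p.1 : ℕ) < p.2 then (true, ⟨(p.2 : ℕ) / n, hdiv p.2⟩)
        else (false, ⟨(p.1 : ℕ) / n, hdiv p.1⟩))
      (fun _ _ => Finset.mem_coe.2 (Finset.mem_univ _)) ?_
    rintro ⟨u, v⟩ hp ⟨u', v'⟩ hp' heq
    simp only [crossingPairs, Finset.coe_filter, Finset.mem_univ, true_and,
      Set.mem_ofPred_eq] at hp hp'
    obtain ⟨h1, h2⟩ := hp
    obtain ⟨h1', h2'⟩ := hp'
    rw [abs_eq zero_le_one] at h1 h1'
    have key : (u : ℕ) = u' ∧ (v : ℕ) = v' := by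
      simp only at heq
      split_ifs at heq with c c' c'
      · simp only [Prod.mk.injEq, Fin.mk.injEq, true_and] at heq
        have e : (v : ℕ) = u + 1 := by omega
        have e' : (v' : ℕ) = u' + 1 := by omega
        have a := hlast u v e h2
        have a' := hlast u' v' e' h2'
        rw [heq] at a
        omega
      · simp at heq
      · simp at heq
      · simp only [Prod.mk.injEq, Fin.mk.injEq, true_and] at heq
        have e : (u : ℕ) = v + 1 := by omega
        have e' : (u' : ℕ) = v' + 1 := by omega
        have a := hlast v u e h2.symm
        have a' := hlast v' u' e' h2'.symm
        rw [heq] at a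
        omega
    exact Prod.ext (Fin.ext key.1) (Fin.ext key.2)
  simpa using h

theorem exists_abs_sub_eq_one_of_sum_eq_one {d : ℕ} {x y : Fin d → ℤ}
    (h : ∑ i, |x i - y i| = 1) : ∃ i, |x i - y i| = 1 ∧ ∀ j, j ≠ i → x j = y j := by
  have hex : ∃ i, x i ≠ y i := by
    by_contra! hall
    simp [hall] at h
  obtain ⟨i, hi⟩ := hex
  have hpos : 1 ≤ |x i - y i| := Int.one_le_abs (sub_ne_zero.2 hi)
  have hs := Finset.add_sum_erase Finset.univ (fun i => |x i - y i|) (Finset.mem_univ i)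
  rw [h] at hs
  have hnn : 0 ≤ ∑ j ∈ Finset.univ.erase i, |x j - y j| := Finset.sum_nonneg fun _ _ => abs_nonneg _
  have h0 : ∑ j ∈ Finset.univ.erase i, |x j - y j| = 0 := by omega
  refine ⟨i, by omega, fun j hj => ?_⟩
  have := (Finset.sum_eq_zero_iff_of_nonneg fun _ _ => abs_nonneg _).1 h0 j
    (Finset.mem_erase.2 ⟨hj, Finset.mem_univ j⟩)
  exact sub_eq_zero.1 (abs_eq_zero.1 this)

/-- Neighbouring pairs of `{0, …, mn - 1}^d` that lie in different blocks of side `n`. -/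
def crossingEdges (d m n : ℕ) : Finset ((Fin d → Fin (m * n)) × (Fin d → Fin (m * n))) :=
  {p | ∑ i, |((p.1 i : ℕ) : ℤ) - ((p.2 i : ℕ) : ℤ)| = 1 ∧
    ∃ i, (p.1 i : ℕ) / n ≠ (p.2 i : ℕ) / n}

/-- Read an edge as a `d`-tuple of coordinate pairs. Exactly one direction carries a crossing pair,
with at most `2 * m` choices; every other direction carries a diagonal pair, with at most `m * n`
choices. -/
theorem card_crossingEdges_le (d m n : ℕ) :
    (crossingEdges d m n).card ≤ d * (2 * m * (m * n) ^ (d - 1)) := by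
  classical
  let diag : Finset (Fin (m * n) × Fin (m * n)) := Finset.univ.image fun u => (u, u)
  have hdiag : diag.card ≤ m * n := by
    refine Finset.card_image_le.trans ?_
    simp
  let T : Fin d → Finset (Fin d → Fin (m * n) × Fin (m * n)) := fun i =>
    Fintype.piFinset (Function.update (fun _ => diag) i (crossingPairs m n))
  have hT : ∀ i, (T i).card ≤ 2 * m * (m * n) ^ (d - 1) := by
    intro i
    simp only [T, Fintype.card_piFinset]
    rw [← Finset.mul_prod_erase _ _ (Finset.mem_univ i), Function.update_self]
    refine Nat.mul_le_mul (card_crossingPairs_le m n) ?_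
    calc ∏ j ∈ Finset.univ.erase i,
          (Function.update (fun _ => diag) i (crossingPairs m n) j).card
        ≤ ∏ _j ∈ Finset.univ.erase i, m * n := by
          refine Finset.prod_le_prod' fun j hj => ?_
          rw [Function.update_of_ne (Finset.ne_of_mem_erase hj)]
          exact hdiag
      _ = (m * n) ^ (d - 1) := by simp [Finset.card_erase_of_mem]
  have hsub : ((crossingEdges d m n).image fun p i => (p.1 i, p.2 i)) ⊆ Finset.univ.biUnion T := by
    intro z hz
    obtain ⟨⟨x, y⟩, hp, rfl⟩ := Finset.mem_image.1 hz
    simp only [crossingEdges, Finset.mem_filter, Finset.mem_univ, true_and] at hp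
    obtain ⟨hsum, j, hj⟩ := hp
    obtain ⟨i, hi, hrest⟩ := exists_abs_sub_eq_one_of_sum_eq_one
      (x := fun i => ((x i : ℕ) : ℤ)) (y := fun i => ((y i : ℕ) : ℤ)) hsum
    have hji : j = i := by
      by_contra hne
      have := hrest j hne
      simp only [Nat.cast_inj] at this
      exact hj (by rw [this])
    subst hji
    refine Finset.mem_biUnion.2 ⟨j, Finset.mem_univ _, Fintype.mem_piFinset.2 fun l => ?_⟩
    by_cases hl : l = j
    · subst hl
      rw [Function.update_self]
      simp [crossingPairs, hi, hj]
    · rw [Function.update_of_ne hl]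
      have := hrest l hl
      simp only [Nat.cast_inj] at this
      exact Finset.mem_image.2 ⟨x l, Finset.mem_univ _, by
        rw [Prod.mk.injEq]; exact ⟨rfl, Fin.ext this⟩⟩
  have hinj : Function.Injective fun (p : (Fin d → Fin (m * n)) × (Fin d → Fin (m * n))) i =>
      (p.1 i, p.2 i) := by
    rintro ⟨x, y⟩ ⟨x', y'⟩ h
    have h' := fun i => congrFun h i
    simp only [Prod.mk.injEq] at h'
    exact Prod.ext (funext fun i => (h' i).1) (funext fun i => (h' i).2)
  calc (crossingEdges d m n).card
      = ((crossingEdges d m n).image fun p i => (p.1 i, p.2 i)).card :=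
        (Finset.card_image_of_injective _ hinj).symm
    _ ≤ (Finset.univ.biUnion T).card := Finset.card_le_card hsub
    _ ≤ ∑ i, (T i).card := Finset.card_biUnion_le
    _ ≤ ∑ _i : Fin d, 2 * m * (m * n) ^ (d - 1) := Finset.sum_le_sum fun i _ => hT i
    _ = d * (2 * m * (m * n) ^ (d - 1)) := by simp

/-- Inside a block the couplings agree by translation invariance; each ordered crossing edge
contributes `|β| / 2`. -/
theorem sum_abs_gridCoupling_sub_block (d m n : ℕ) (β : ℝ) :
    ∑ p, ∑ q, |gridCoupling d (m * n) β (blockEquiv d m n p) (blockEquiv d m n q)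
        - (if p.1 = q.1 then gridCoupling d n β p.2 q.2 else 0)|
      = |β| / 2 * (crossingEdges d m n).card := by
  have hterm : ∀ p q, |gridCoupling d (m * n) β (blockEquiv d m n p) (blockEquiv d m n q)
        - (if p.1 = q.1 then gridCoupling d n β p.2 q.2 else 0)|
      = |β| / 2 * if (blockEquiv d m n p, blockEquiv d m n q) ∈ crossingEdges d m n
        then 1 else 0 := by
    intro p q
    have hmem : (blockEquiv d m n p, blockEquiv d m n q) ∈ crossingEdges d m n ↔
        ∑ i, |((blockEquiv d m n p i : ℕ) : ℤ) - ((blockEquiv d m n q i : ℕ) : ℤ)| = 1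
          ∧ p.1 ≠ q.1 := by
      simp only [crossingEdges, Finset.mem_filter, Finset.mem_univ, true_and, blockEquiv_div,
        Function.ne_iff, ne_eq, Fin.val_inj]
    by_cases hpq : p.1 = q.1
    · have hs : ∑ i, |((blockEquiv d m n p i : ℕ) : ℤ) - ((blockEquiv d m n q i : ℕ) : ℤ)|
          = ∑ i, |((p.2 i : ℕ) : ℤ) - ((q.2 i : ℕ) : ℤ)| := by
        refine Finset.sum_congr rfl fun i _ => ?_
        rw [blockEquiv_apply, blockEquiv_apply, hpq]
        push_cast
        congr 1
        ring
      have hno : (blockEquiv d m n p, blockEquiv d m n q) ∉ crossingEdges d m n := fun h =>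
        (hmem.1 h).2 hpq
      rw [if_neg hno, if_pos hpq]
      unfold gridCoupling
      rw [hs]
      simp
    · rw [if_neg hpq, sub_zero]
      unfold gridCoupling
      simp only [hmem, ne_eq, hpq, not_false_eq_true, and_true]
      split_ifs
      · rw [mul_one, mul_one, abs_mul]
        norm_num
        ring
      · simp
  simp only [hterm, ← Finset.mul_sum]
  congr 1
  rw [← Fintype.sum_prod_type',
    ← (Equiv.prodCongr (blockEquiv d m n) (blockEquiv d m n)).symm.sum_comp]
  simp

theorem abs_meanFreeEnergy_mul_sub_le (d m n : ℕ) (hd : 1 ≤ d) (hm : 0 < m) (hn : 0 < n)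
    (β h : ℝ) :
    |meanFreeEnergy d (m * n) β h - meanFreeEnergy d n β h| ≤ |β| * d / n := by
  have h1 := abs_meanLogZ_sub_le
    (fun p q => gridCoupling d (m * n) β (blockEquiv d m n p) (blockEquiv d m n q))
    (fun p q => if p.1 = q.1 then gridCoupling d n β p.2 q.2 else 0) h
  rw [sum_abs_gridCoupling_sub_block, meanLogZ_comp_equiv (blockEquiv d m n), meanLogZ_block] at h1
  have h2 : ((crossingEdges d m n).card : ℝ) ≤ d * (2 * m * (m * n : ℝ) ^ (d - 1)) := by
    exact_mod_cast card_crossingEdges_le d m n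
  have hm' : (0 : ℝ) < m := by exact_mod_cast hm
  have hn' : (0 : ℝ) < n := by exact_mod_cast hn
  have hN : (0 : ℝ) < (m * n : ℝ) ^ d := by positivity
  have e : meanFreeEnergy d (m * n) β h - meanFreeEnergy d n β h
      = (meanLogZ (gridCoupling d (m * n) β) h
        - Fintype.card (Fin d → Fin m) * meanLogZ (gridCoupling d n β) h) / (m * n : ℝ) ^ d := by
    rw [meanFreeEnergy_eq, meanFreeEnergy_eq]
    simp only [Fintype.card_pi, Fintype.card_fin, Finset.prod_const, Finset.card_univ]
    push_cast
    rw [sub_div, mul_pow, mul_div_mul_left _ _ (by positivity)]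
  rw [e, abs_div, abs_of_pos hN, div_le_div_iff₀ hN hn']
  have hpow : (m * n : ℝ) ^ d = (m * n : ℝ) ^ (d - 1) * (m * n) := by
    rw [← pow_succ, Nat.sub_add_cancel hd]
  calc _ ≤ |β| / 2 * (d * (2 * m * (m * n : ℝ) ^ (d - 1))) * n := by
        gcongr
        exact h1.trans (by gcongr)
    _ = |β| * d * (m * n : ℝ) ^ d := by rw [hpow]; ring

/-- Sides `m` and `n` are both compared with side `m * n`, so neither monotonicity nor divisibility
is needed. -/
theorem cauchySeq_meanFreeEnergy (d : ℕ) (hd : 1 ≤ d) (β h : ℝ) :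
    CauchySeq fun n => meanFreeEnergy d n β h := by
  refine Metric.cauchySeq_iff.2 fun ε hε => ?_
  obtain ⟨N, hN⟩ := exists_nat_gt (2 * (|β| * d) / ε)
  refine ⟨N + 1, fun m hm n hn => ?_⟩
  have hb : ∀ k : ℕ, N + 1 ≤ k → |β| * d / k < ε / 2 := by
    intro k hk
    have hk' : (N : ℝ) + 1 ≤ k := by exact_mod_cast hk
    have hk0 : (0 : ℝ) < k := by linarith [Nat.cast_nonneg (α := ℝ) N]
    rw [div_lt_iff₀ hε] at hN
    rw [div_lt_div_iff₀ hk0 two_pos]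
    nlinarith
  have h1 := abs_meanFreeEnergy_mul_sub_le d m n hd (by omega) (by omega) β h
  have h2 := abs_meanFreeEnergy_mul_sub_le d n m hd (by omega) (by omega) β h
  rw [mul_comm n m] at h2
  rw [Real.dist_eq]
  have h3 := abs_sub_le (meanFreeEnergy d m β h) (meanFreeEnergy d (m * n) β h)
    (meanFreeEnergy d n β h)
  rw [abs_sub_comm] at h2
  linarith [hb m hm, hb n hn]

theorem tendsto_meanFreeEnergy (d : ℕ) (hd : 1 ≤ d) (β h : ℝ) :
    Tendsto (fun n => meanFreeEnergy d n β h) atTop (nhds (limitFreeEnergy d β h)) :=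
  (cauchySeq_meanFreeEnergy d hd β h).tendsto_limUnder

theorem integrable_freeEnergyDensity (d n : ℕ) (β h : ℝ) :
    Integrable (fun g => freeEnergyDensity β h g) (disorderLaw d n) := by
  unfold freeEnergyDensity disorderLaw
  simp only [log_partitionFunction]
  exact (integrable_logZ _ h).div_const _

theorem integral_abs_freeEnergyDensity_sub_le (d n : ℕ) (hn : 0 < n) (β h : ℝ) :
    ∫ g, |freeEnergyDensity β h g - meanFreeEnergy d n β h| ∂(disorderLaw d n)
      ≤ |h| / √((n : ℝ) ^ d) := by
  have hN : (0 : ℝ) < (n : ℝ) ^ d := by positivity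
  have key := integral_abs_logZ_sub_le (boxCoupling d n β) h
  have e : ∀ g : Disorder d n, |freeEnergyDensity β h g - meanFreeEnergy d n β h|
      = |logZ (boxCoupling d n β) h g - meanLogZ (boxCoupling d n β) h| / (n : ℝ) ^ d := by
    intro g
    have h1 : meanFreeEnergy d n β h = meanLogZ (boxCoupling d n β) h / (n : ℝ) ^ d := by
      unfold meanFreeEnergy freeEnergyDensity meanLogZ disorderLaw
      rw [integral_div, card_box]
      simp only [log_partitionFunction, Nat.cast_pow]
    rw [h1, freeEnergyDensity, log_partitionFunction, card_box, Nat.cast_pow, ← sub_div, abs_div,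
      abs_of_pos hN]
  simp only [e]
  rw [integral_div, disorderLaw, div_le_div_iff₀ hN (Real.sqrt_pos.2 hN)]
  rw [Fintype.card_coe, card_box, Nat.cast_pow] at key
  calc _ ≤ |h| * √((n : ℝ) ^ d) * √((n : ℝ) ^ d) := by gcongr
    _ = |h| * (n : ℝ) ^ d := by rw [mul_assoc, Real.mul_self_sqrt hN.le]

theorem tendsto_integral_abs_freeEnergyDensity_sub (d : ℕ) (hd : 1 ≤ d) (β h : ℝ) :
    Tendsto (fun n : ℕ => ∫ g, |freeEnergyDensity β h g - meanFreeEnergy d n β h|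
      ∂(disorderLaw d n)) atTop (nhds 0) := by
  have hlim : Tendsto (fun n : ℕ => |h| / √((n : ℝ) ^ d)) atTop (nhds 0) := by
    refine Tendsto.div_atTop tendsto_const_nhds (Real.tendsto_sqrt_atTop.comp ?_)
    exact (tendsto_pow_atTop (by omega)).comp tendsto_natCast_atTop_atTop
  refine squeeze_zero' (Eventually.of_forall fun n => integral_nonneg fun g => abs_nonneg _) ?_ hlim
  filter_upwards [eventually_gt_atTop 0] with n hn
  exact integral_abs_freeEnergyDensity_sub_le d n hn β h

/-! ### Gibbs averages -/

theorem abs_le_sum_abs {S : Type*} [Fintype S] (F : S → ℝ) (s : S) : |F s| ≤ ∑ s, |F s| :=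
  Finset.single_le_sum (f := fun s => |F s|) (fun _ _ => abs_nonneg _) (Finset.mem_univ s)

section Gibbs

variable {d n m : ℕ} (β h : ℝ)

instance : IsProbabilityMeasure (disorderLaw d n) := by
  unfold disorderLaw
  infer_instance

theorem abs_spin (σ : Config d n) (x : box d n) : |spin σ x| = 1 := abs_units_int _

theorem spin_mul_self (σ : Config d n) (x : box d n) : spin σ x * spin σ x = 1 := by
  rw [← abs_mul_abs_self, abs_spin, one_mul]

theorem partitionFunction_pos (g : Disorder d n) : 0 < partitionFunction β h g :=
  Finset.sum_pos (fun _ _ => Real.exp_pos _) Finset.univ_nonempty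

theorem gibbsWeight_pos (g : Disorder d n) (σ : Config d n) : 0 < gibbsWeight β h g σ :=
  div_pos (Real.exp_pos _) (partitionFunction_pos β h g)

theorem sum_gibbsWeight (g : Disorder d n) : ∑ σ, gibbsWeight β h g σ = 1 := by
  unfold gibbsWeight
  rw [← Finset.sum_div]
  exact div_self (partitionFunction_pos β h g).ne'

theorem continuous_exponent (σ : Config d n) :
    Continuous fun g : Disorder d n => exponent β h g σ := by
  unfold exponent
  fun_prop

theorem continuous_partitionFunction :
    Continuous fun g : Disorder d n => partitionFunction β h g :=
  continuous_finsetSum _ fun σ _ => (continuous_exponent β h σ).rexp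

theorem continuous_gibbsWeight (σ : Config d n) :
    Continuous fun g : Disorder d n => gibbsWeight β h g σ :=
  (continuous_exponent β h σ).rexp.div (continuous_partitionFunction β h)
    fun g => (partitionFunction_pos β h g).ne'

theorem continuous_gibbsAvg {F : Disorder d n → (Fin m → Config d n) → ℝ}
    (hF : ∀ s, Continuous fun g => F g s) :
    Continuous fun g : Disorder d n => gibbsAvg β h g (F g) :=
  continuous_finsetSum _ fun s _ =>
    (continuous_finsetProd _ fun i _ => continuous_gibbsWeight β h (s i)).mul (hF s)

/-- The factors of a product over the replicas are averaged separately. -/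
theorem gibbsAvg_prod (g : Disorder d n) (φ : Fin m → Config d n → ℝ) :
    gibbsAvg β h g (fun s => ∏ i, φ i (s i)) = ∏ i, ∑ σ, gibbsWeight β h g σ * φ i σ := by
  unfold gibbsAvg
  rw [Finset.prod_univ_sum, Fintype.piFinset_univ]
  simp only [Finset.prod_mul_distrib]

theorem gibbsAvg_single (g : Disorder d n) (i : Fin m) (φ : Config d n → ℝ) :
    gibbsAvg β h g (fun s => φ (s i)) = ∑ σ, gibbsWeight β h g σ * φ σ := by
  have e := gibbsAvg_prod β h g (fun j : Fin m => if j = i then φ else fun _ => 1)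
  rw [Fintype.prod_eq_single i fun j hj => by simp [hj, sum_gibbsWeight]] at e
  simp only [if_true] at e
  rw [← e]
  congr 1
  funext s
  rw [Fintype.prod_eq_single i fun j hj => by simp [hj]]
  simp

theorem gibbsAvg_pair (g : Disorder d n) {i j : Fin m} (hij : i ≠ j) (φ χ : Config d n → ℝ) :
    gibbsAvg β h g (fun s => φ (s i) * χ (s j))
      = (∑ σ, gibbsWeight β h g σ * φ σ) * ∑ σ, gibbsWeight β h g σ * χ σ := by
  have e := gibbsAvg_prod β h g
    (fun l : Fin m => if l = i then φ else if l = j then χ else fun _ => 1)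
  rw [Fintype.prod_eq_mul i j hij fun l hl => by simp [hl.1, hl.2, sum_gibbsWeight]] at e
  simp only [if_true, hij.symm, if_false] at e
  rw [← e]
  congr 1
  funext s
  rw [Fintype.prod_eq_mul i j hij fun l hl => by simp [hl.1, hl.2]]
  simp [hij.symm]

theorem gibbsAvg_const (g : Disorder d n) (c : ℝ) :
    gibbsAvg β h g (fun _ : Fin m → Config d n => c) = c := by
  have e := gibbsAvg_prod β h g (fun (_ : Fin m) (_ : Config d n) => (1 : ℝ))
  simp only [Finset.prod_const_one, mul_one, sum_gibbsWeight] at e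
  unfold gibbsAvg at e ⊢
  rw [← Finset.sum_mul]
  simp only [mul_one] at e
  rw [e, one_mul]

theorem gibbsAvg_init_mul_last (g : Disorder d n) (F : (Fin m → Config d n) → ℝ)
    (φ : Config d n → ℝ) :
    gibbsAvg β h g (fun s : Fin (m + 1) → Config d n =>
        F (fun i => s i.castSucc) * φ (s (Fin.last m)))
      = gibbsAvg β h g F * ∑ σ, gibbsWeight β h g σ * φ σ := by
  unfold gibbsAvg
  rw [← (Fin.snocEquiv fun _ : Fin (m + 1) => Config d n).sum_comp, Fintype.sum_prod_type_right,
    Finset.sum_mul]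
  refine Finset.sum_congr rfl fun s _ => ?_
  rw [Finset.mul_sum]
  refine Finset.sum_congr rfl fun σ _ => ?_
  simp only [Fin.snocEquiv_apply, Fin.prod_univ_castSucc, Fin.snoc_castSucc, Fin.snoc_last]
  ring

theorem gibbsAvg_init (g : Disorder d n) (F : (Fin m → Config d n) → ℝ) :
    gibbsAvg β h g (fun s : Fin (m + 1) → Config d n => F (fun i => s i.castSucc))
      = gibbsAvg β h g F := by
  have e := gibbsAvg_init_mul_last β h g F fun _ => 1
  simpa [sum_gibbsWeight] using e

theorem abs_gibbsAvg_le (g : Disorder d n) {F G : (Fin m → Config d n) → ℝ}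
    (hFG : ∀ s, |F s| ≤ G s) : |gibbsAvg β h g F| ≤ gibbsAvg β h g G := by
  unfold gibbsAvg
  refine (Finset.abs_sum_le_sum_abs _ _).trans (Finset.sum_le_sum fun s _ => ?_)
  have hp : 0 ≤ ∏ i, gibbsWeight β h g (s i) :=
    Finset.prod_nonneg fun i _ => (gibbsWeight_pos β h g (s i)).le
  rw [abs_mul, abs_of_nonneg hp]
  exact mul_le_mul_of_nonneg_left (hFG s) hp

theorem abs_gibbsAvg_le_const (g : Disorder d n) {F : (Fin m → Config d n) → ℝ} {C : ℝ}
    (hF : ∀ s, |F s| ≤ C) : |gibbsAvg β h g F| ≤ C :=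
  (abs_gibbsAvg_le β h g hF).trans_eq (gibbsAvg_const β h g C)

theorem gibbsAvg_sum {ι : Type*} (t : Finset ι) (g : Disorder d n)
    (F : ι → (Fin m → Config d n) → ℝ) :
    gibbsAvg β h g (fun s => ∑ i ∈ t, F i s) = ∑ i ∈ t, gibbsAvg β h g (F i) := by
  unfold gibbsAvg
  simp only [Finset.mul_sum]
  exact Finset.sum_comm

theorem gibbsAvg_const_mul (g : Disorder d n) (c : ℝ) (F : (Fin m → Config d n) → ℝ) :
    gibbsAvg β h g (fun s => c * F s) = c * gibbsAvg β h g F := by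
  unfold gibbsAvg
  rw [Finset.mul_sum]
  exact Finset.sum_congr rfl fun s _ => by ring

theorem gibbsAvg_sub (g : Disorder d n) (F G : (Fin m → Config d n) → ℝ) :
    gibbsAvg β h g (fun s => F s - G s) = gibbsAvg β h g F - gibbsAvg β h g G := by
  unfold gibbsAvg
  rw [← Finset.sum_sub_distrib]
  exact Finset.sum_congr rfl fun s _ => by ring

theorem integrable_gibbsAvg (F : (Fin m → Config d n) → ℝ) :
    Integrable (fun g => gibbsAvg β h g F) (disorderLaw d n) := by
  have hc : Continuous fun g : Disorder d n => gibbsAvg β h g F :=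
    continuous_gibbsAvg β h (F := fun _ => F) fun s => continuous_const
  have hb : ∀ g : Disorder d n, ‖gibbsAvg β h g F‖ ≤ ∑ s, |F s| := fun g =>
    abs_gibbsAvg_le_const β h g (abs_le_sum_abs F)
  exact Integrable.of_bound hc.aestronglyMeasurable _ (ae_of_all _ hb)

theorem quenchedAvg_init (F : (Fin m → Config d n) → ℝ) :
    quenchedAvg β h (fun s : Fin (m + 1) → Config d n => F (fun i => s i.castSucc))
      = quenchedAvg β h F := by
  unfold quenchedAvg
  simp only [gibbsAvg_init]

theorem quenchedAvg_const (c : ℝ) :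
    quenchedAvg β h (fun _ : Fin m → Config d n => c) = c := by
  simp [quenchedAvg, gibbsAvg_const]

theorem abs_quenchedAvg_le {F : (Fin m → Config d n) → ℝ} {C : ℝ} (hF : ∀ s, |F s| ≤ C) :
    |quenchedAvg β h F| ≤ C := by
  have hb : ∀ g : Disorder d n, ‖gibbsAvg β h g F‖ ≤ C := fun g =>
    abs_gibbsAvg_le_const β h g hF
  simpa [quenchedAvg] using
    norm_integral_le_of_norm_le_const (μ := disorderLaw d n) (ae_of_all _ hb)

theorem quenchedAvg_sum {ι : Type*} (t : Finset ι) (F : ι → (Fin m → Config d n) → ℝ) :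
    quenchedAvg β h (fun s => ∑ i ∈ t, F i s) = ∑ i ∈ t, quenchedAvg β h (F i) := by
  unfold quenchedAvg
  simp only [gibbsAvg_sum]
  exact integral_finsetSum _ fun i _ => integrable_gibbsAvg β h (F i)

theorem quenchedAvg_const_mul (c : ℝ) (F : (Fin m → Config d n) → ℝ) :
    quenchedAvg β h (fun s => c * F s) = c * quenchedAvg β h F := by
  unfold quenchedAvg
  simp only [gibbsAvg_const_mul]
  exact integral_const_mul _ _

theorem quenchedAvg_sub (F G : (Fin m → Config d n) → ℝ) :
    quenchedAvg β h (fun s => F s - G s) = quenchedAvg β h F - quenchedAvg β h G := by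
  unfold quenchedAvg
  simp only [gibbsAvg_sub]
  exact integral_sub (integrable_gibbsAvg β h F) (integrable_gibbsAvg β h G)

/-! ### Overlaps -/

theorem abs_overlap_le_one (σ τ : Config d n) : |overlap σ τ| ≤ 1 := by
  unfold overlap
  rw [abs_div, Nat.abs_cast]
  refine div_le_one_of_le₀ ((Finset.abs_sum_le_sum_abs _ _).trans ?_) (Nat.cast_nonneg _)
  simp [abs_mul, abs_spin]

theorem overlap_self (hn : 0 < n) (σ : Config d n) : overlap σ σ = 1 := by
  unfold overlap
  have : ((box d n).card : ℝ) ≠ 0 := by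
    rw [card_box]
    positivity
  simp [spin_mul_self, this]

/-- Distinct replicas are independent, so both sides are the mean of `⟨σ_x⟩²` over the sites. The
number of replicas may differ, which lets the one-replica identity be used among `k + 1` replicas.
-/
theorem gibbsAvg_overlap {m' : ℕ} (g : Disorder d n) {i j : Fin m} (hij : i ≠ j) {i' j' : Fin m'}
    (hij' : i' ≠ j') :
    gibbsAvg β h g (fun s : Fin m → Config d n => overlap (s i) (s j))
      = gibbsAvg β h g (fun s : Fin m' → Config d n => overlap (s i') (s j')) := by
  unfold overlap
  simp only [div_eq_inv_mul, gibbsAvg_const_mul, gibbsAvg_sum]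
  congr 1
  refine Finset.sum_congr rfl fun x _ => ?_
  rw [gibbsAvg_pair β h g hij (fun σ => spin σ x) (fun σ => spin σ x),
    gibbsAvg_pair β h g hij' (fun σ => spin σ x) (fun σ => spin σ x)]

theorem quenchedAvg_overlap {m' : ℕ} {i j : Fin m} (hij : i ≠ j) {i' j' : Fin m'}
    (hij' : i' ≠ j') :
    quenchedAvg β h (fun s : Fin m → Config d n => overlap (s i) (s j))
      = quenchedAvg β h (fun s : Fin m' → Config d n => overlap (s i') (s j')) := by
  unfold quenchedAvg
  simp only [gibbsAvg_overlap β h _ hij hij']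

/-! ### Gaussian integration by parts -/

/-- The magnetization `⟨σ_x⟩`. -/
noncomputable def magnetization (g : Disorder d n) (x : box d n) : ℝ :=
  ∑ σ, gibbsWeight β h g σ * spin σ x

theorem abs_magnetization_le_one (g : Disorder d n) (x : box d n) :
    |magnetization β h g x| ≤ 1 := by
  unfold magnetization
  refine (Finset.abs_sum_le_sum_abs _ _).trans_eq ?_
  simp only [abs_mul, abs_spin, mul_one, abs_of_pos (gibbsWeight_pos β h g _), sum_gibbsWeight]

theorem continuous_magnetization (x : box d n) :
    Continuous fun g : Disorder d n => magnetization β h g x :=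
  continuous_finsetSum _ fun σ _ => (continuous_gibbsWeight β h σ).mul continuous_const

theorem hasDerivAt_exponent_update (g : Disorder d n) (x : box d n) (σ : Config d n) (t : ℝ) :
    HasDerivAt (fun t => exponent β h (Function.update g x t) σ) (h * spin σ x) t := by
  have e : (fun t => exponent β h (Function.update g x t) σ)
      = fun t => exponent β h g σ + h * ((t - g x) * spin σ x) := by
    funext t
    have e1 : ∑ y, Function.update g x t y * spin σ y
        = ∑ y, g y * spin σ y + (t - g x) * spin σ x := by
      rw [← sub_eq_iff_eq_add', ← Finset.sum_sub_distrib, Finset.sum_eq_single x]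
      · simp [sub_mul]
      · intro y _ hy
        simp [hy]
      · simp
    unfold exponent
    rw [e1]
    ring
  rw [e]
  have h1 := ((((hasDerivAt_id t).sub_const (g x)).mul_const (spin σ x)).const_mul h).const_add
    (exponent β h g σ)
  simpa using h1

theorem hasDerivAt_log_partitionFunction_update (g : Disorder d n) (x : box d n) (t : ℝ) :
    HasDerivAt (fun t => Real.log (partitionFunction β h (Function.update g x t)))
      (h * magnetization β h (Function.update g x t) x) t := by
  have h1 : HasDerivAt (fun t => partitionFunction β h (Function.update g x t))
      (∑ σ, Real.exp (exponent β h (Function.update g x t) σ) * (h * spin σ x)) t :=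
    HasDerivAt.fun_sum fun σ _ => (hasDerivAt_exponent_update β h g x σ t).exp
  convert! h1.log (partitionFunction_pos β h _).ne' using 1
  unfold magnetization gibbsWeight
  rw [Finset.mul_sum, Finset.sum_div]
  exact Finset.sum_congr rfl fun σ _ => by ring

theorem prod_gibbsWeight (g : Disorder d n) (s : Fin m → Config d n) :
    ∏ i, gibbsWeight β h g (s i)
      = Real.exp (∑ i, exponent β h g (s i) - m * Real.log (partitionFunction β h g)) := by
  rw [Real.exp_sub, Real.exp_sum, Real.exp_nat_mul, Real.exp_log (partitionFunction_pos β h g)]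
  simp [gibbsWeight, Finset.prod_div_distrib]

/-- Once the product of weights is written as one exponential, its logarithmic derivative is `h`
times the sum over replicas of `σ_x - ⟨σ_x⟩`. -/
theorem hasDerivAt_gibbsAvg_update (F : (Fin m → Config d n) → ℝ) (x : box d n)
    (g : Disorder d n) (t : ℝ) :
    HasDerivAt (fun t => gibbsAvg β h (Function.update g x t) F)
      (gibbsAvg β h (Function.update g x t) fun s =>
        F s * (h * (∑ i, spin (s i) x - m * magnetization β h (Function.update g x t) x))) t := by
  unfold gibbsAvg
  refine HasDerivAt.fun_sum fun s _ => ?_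
  simp only [prod_gibbsWeight]
  have h1 : HasDerivAt (fun t => ∑ i, exponent β h (Function.update g x t) (s i)
      - m * Real.log (partitionFunction β h (Function.update g x t)))
      (∑ i, h * spin (s i) x - m * (h * magnetization β h (Function.update g x t) x)) t :=
    (HasDerivAt.fun_sum fun i _ => hasDerivAt_exponent_update β h g x (s i) t).sub
      ((hasDerivAt_log_partitionFunction_update β h g x t).const_mul _)
  convert! h1.exp.mul_const (F s) using 1
  rw [← Finset.mul_sum]
  ring

/-- The factor `⟨σ_x⟩` produced by the derivative is realized as the spin of a fresh independent
replica; this is where replica `m + 1` enters. -/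
theorem integral_mul_gibbsAvg (F : (Fin m → Config d n) → ℝ) (x : box d n) :
    ∫ g, g x * gibbsAvg β h g F ∂(disorderLaw d n)
      = h * quenchedAvg β h (fun s : Fin (m + 1) → Config d n => F (fun i => s i.castSucc)
          * (∑ i : Fin m, spin (s i.castSucc) x - m * spin (s (Fin.last m)) x)) := by
  have hF1 : ∀ s, |F s| ≤ ∑ s, |F s| := abs_le_sum_abs F
  have hbd : ∀ (g : Disorder d n) (s : Fin m → Config d n),
      |F s * (h * (∑ i, spin (s i) x - m * magnetization β h g x))|
        ≤ (∑ s, |F s|) * (|h| * (m + m)) := by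
    intro g s
    have ha : |∑ i, spin (s i) x| ≤ m := by
      refine (Finset.abs_sum_le_sum_abs _ _).trans_eq ?_
      simp [abs_spin]
    have hb : |(m : ℝ) * magnetization β h g x| ≤ m := by
      rw [abs_mul, Nat.abs_cast]
      exact mul_le_of_le_one_right (Nat.cast_nonneg _) (abs_magnetization_le_one β h g x)
    rw [abs_mul, abs_mul]
    have hs : |∑ i, spin (s i) x - m * magnetization β h g x| ≤ m + m :=
      (abs_sub _ _).trans (add_le_add ha hb)
    exact mul_le_mul (hF1 s) (mul_le_mul_of_nonneg_left hs (abs_nonneg h)) (by positivity)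
      (Finset.sum_nonneg fun _ _ => abs_nonneg _)
  have hibp := integral_eval_mul_stdGaussianPi x
    (F := fun g : Disorder d n => gibbsAvg β h g F)
    (F' := fun g => gibbsAvg β h g fun s =>
        F s * (h * (∑ i, spin (s i) x - m * magnetization β h g x)))
    (continuous_gibbsAvg β h fun s => continuous_const)
    (continuous_gibbsAvg β h fun s => continuous_const.mul (continuous_const.mul
      (continuous_const.sub (continuous_const.mul (continuous_magnetization β h x)))))
    (hasDerivAt_gibbsAvg_update β h F x)
    (fun g => abs_gibbsAvg_le_const β h g hF1)
    (fun g => abs_gibbsAvg_le_const β h g (hbd g))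
  refine Eq.trans hibp ?_
  unfold quenchedAvg
  rw [← integral_const_mul]
  refine integral_congr_ae (ae_of_all _ fun g => ?_)
  have e1 : gibbsAvg β h g (fun s => F s * (h * (∑ i, spin (s i) x - m * magnetization β h g x)))
      = h * (gibbsAvg β h g (fun s => F s * ∑ i, spin (s i) x)
        - m * (gibbsAvg β h g F * magnetization β h g x)) := by
    have e2 : (fun s : Fin m → Config d n =>
        F s * (h * (∑ i, spin (s i) x - m * magnetization β h g x)))
        = fun s => h * (F s * ∑ i, spin (s i) x - (m * magnetization β h g x) * F s) := by
      funext s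
      ring
    rw [e2, gibbsAvg_const_mul, gibbsAvg_sub, gibbsAvg_const_mul]
    ring
  have e3 : (fun s : Fin (m + 1) → Config d n => F (fun i => s i.castSucc)
      * (∑ i : Fin m, spin (s i.castSucc) x - m * spin (s (Fin.last m)) x))
      = fun s => F (fun i => s i.castSucc) * (∑ i : Fin m, spin (s i.castSucc) x)
        - m * (F (fun i => s i.castSucc) * spin (s (Fin.last m)) x) := by
    funext s
    ring
  simp only [e1]
  rw [e3, gibbsAvg_sub, gibbsAvg_const_mul, gibbsAvg_init_mul_last β h g F fun σ => spin σ x,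
    gibbsAvg_init β h g fun s => F s * ∑ i, spin (s i) x]
  rfl

/-- The normalized field energy `|V_n|⁻¹ ∑_x g_x σ_x`. -/
noncomputable def fieldDensity (g : Disorder d n) (σ : Config d n) : ℝ :=
  (∑ x, g x * spin σ x) / ((box d n).card : ℝ)

theorem continuous_fieldDensity (σ : Config d n) :
    Continuous fun g : Disorder d n => fieldDensity g σ := by
  unfold fieldDensity
  fun_prop

theorem gibbsAvg_mul_fieldDensity (g : Disorder d n) (F : (Fin m → Config d n) → ℝ) (i₀ : Fin m) :
    gibbsAvg β h g (fun s => F s * fieldDensity g (s i₀))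
      = (∑ x, g x * gibbsAvg β h g (fun s => F s * spin (s i₀) x)) / ((box d n).card : ℝ) := by
  have e : (fun s : Fin m → Config d n => F s * fieldDensity g (s i₀))
      = fun s => ((box d n).card : ℝ)⁻¹ * ∑ x, g x * (F s * spin (s i₀) x) := by
    funext s
    rw [fieldDensity, div_eq_inv_mul, mul_left_comm, Finset.mul_sum]
    congr 1
    exact Finset.sum_congr rfl fun x _ => by ring
  rw [e, gibbsAvg_const_mul, gibbsAvg_sum, div_eq_inv_mul]
  simp only [gibbsAvg_const_mul]

theorem integrable_eval_mul_gibbsAvg (F : (Fin m → Config d n) → ℝ) (x : box d n) :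
    Integrable (fun g => g x * gibbsAvg β h g F) (disorderLaw d n) := by
  have hc : Continuous fun g : Disorder d n => gibbsAvg β h g F :=
    continuous_gibbsAvg β h (F := fun _ => F) fun s => continuous_const
  have hb : ∀ g : Disorder d n, ‖gibbsAvg β h g F‖ ≤ ∑ s, |F s| := fun g =>
    abs_gibbsAvg_le_const β h g (abs_le_sum_abs F)
  exact (integrable_eval_stdGaussianPi x).mul_bdd hc.aestronglyMeasurable (ae_of_all _ hb)

theorem integrable_gibbsAvg_mul_fieldDensity (F : (Fin m → Config d n) → ℝ) (i₀ : Fin m) :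
    Integrable (fun g => gibbsAvg β h g (fun s => F s * fieldDensity g (s i₀)))
      (disorderLaw d n) := by
  simp only [gibbsAvg_mul_fieldDensity]
  exact (integrable_finsetSum _ fun x _ => integrable_eval_mul_gibbsAvg β h _ x).div_const _

/-- Gaussian integration by parts for the field energy of one of the replicas. -/
theorem integral_gibbsAvg_mul_fieldDensity (F : (Fin m → Config d n) → ℝ) (i₀ : Fin m) :
    ∫ g, gibbsAvg β h g (fun s => F s * fieldDensity g (s i₀)) ∂(disorderLaw d n)
      = h * (∑ i : Fin m, quenchedAvg β h (fun s : Fin (m + 1) → Config d n =>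
            F (fun i => s i.castSucc) * overlap (s i₀.castSucc) (s i.castSucc))
          - m * quenchedAvg β h (fun s : Fin (m + 1) → Config d n =>
            F (fun i => s i.castSucc) * overlap (s i₀.castSucc) (s (Fin.last m)))) := by
  simp only [gibbsAvg_mul_fieldDensity]
  rw [integral_div, integral_finsetSum _ fun x _ => integrable_eval_mul_gibbsAvg β h _ x]
  simp only [integral_mul_gibbsAvg]
  rw [← Finset.mul_sum, ← quenchedAvg_sum, ← quenchedAvg_sum, ← quenchedAvg_const_mul β h (m : ℝ),
    ← quenchedAvg_sub, mul_div_assoc, div_eq_inv_mul, ← quenchedAvg_const_mul]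
  congr 2
  funext s
  unfold overlap
  simp only [mul_div_assoc', ← Finset.sum_div, ← sub_div]
  rw [inv_mul_eq_div]
  congr 1
  simp only [Finset.mul_sum]
  rw [Finset.sum_comm, ← Finset.sum_sub_distrib]
  refine Finset.sum_congr rfl fun x _ => ?_
  rw [mul_sub, Finset.mul_sum]
  congr 1
  · exact Finset.sum_congr rfl fun i _ => by ring
  · ring

end Gibbs

/-! ### Concentration of the field energy -/

section Concentration

variable {d n : ℕ} (β h : ℝ)

/-- The difference quotient of `t ↦ ψ_n(β,t)` at `h`, minus `q`. -/
noncomputable def slopeError (q t : ℝ) (g : Disorder d n) : ℝ :=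
  t⁻¹ * (freeEnergyDensity β (h + t) g - freeEnergyDensity β h g) - q

theorem exp_mul_freeEnergyDensity (hn : 0 < n) (g : Disorder d n) :
    Real.exp ((n : ℝ) ^ d * freeEnergyDensity β h g) = partitionFunction β h g := by
  have hN : (n : ℝ) ^ d ≠ 0 := by positivity
  rw [freeEnergyDensity, card_box, Nat.cast_pow, mul_div_cancel₀ _ hN,
    Real.exp_log (partitionFunction_pos β h g)]

theorem exponent_add (g : Disorder d n) (hn : 0 < n) (t : ℝ) (σ : Config d n) :
    exponent β (h + t) g σ = exponent β h g σ + t * ((n : ℝ) ^ d * fieldDensity g σ) := by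
  have hN : (n : ℝ) ^ d ≠ 0 := by positivity
  rw [fieldDensity, card_box, Nat.cast_pow, mul_div_cancel₀ _ hN]
  unfold exponent
  ring

/-- The exponential moments of the field energy are ratios of partition functions. -/
theorem sum_gibbsWeight_mul_exp (hn : 0 < n) (g : Disorder d n) (q : ℝ) {t : ℝ} (ht : t ≠ 0) :
    ∑ σ, gibbsWeight β h g σ * Real.exp (t * ((n : ℝ) ^ d * (fieldDensity g σ - q)))
      = Real.exp (t * (n : ℝ) ^ d * slopeError β h q t g) := by
  have e1 : t * (n : ℝ) ^ d * slopeError β h q t g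
      = (n : ℝ) ^ d * freeEnergyDensity β (h + t) g - (n : ℝ) ^ d * freeEnergyDensity β h g
        - t * ((n : ℝ) ^ d * q) := by
    unfold slopeError
    field_simp
  rw [e1, Real.exp_sub, Real.exp_sub, exp_mul_freeEnergyDensity _ _ hn,
    exp_mul_freeEnergyDensity _ _ hn, partitionFunction, Finset.sum_div, Finset.sum_div]
  refine Finset.sum_congr rfl fun σ _ => ?_
  rw [exponent_add β h g hn, gibbsWeight, mul_sub, mul_sub, Real.exp_sub, Real.exp_add]
  ring

/-- Jensen for `exp`, then `exp |u| ≤ exp u + exp (-u)`: the two exponential moments are known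
exactly. Bounding both by a common exponential costs the `Real.log 2`. -/
theorem sum_gibbsWeight_mul_abs_le (hn : 0 < n) (g : Disorder d n) (q : ℝ) {δ : ℝ} (hδ : 0 < δ) :
    ∑ σ, gibbsWeight β h g σ * |fieldDensity g σ - q|
      ≤ Real.log 2 / (δ * (n : ℝ) ^ d) + (|slopeError β h q δ g| + |slopeError β h q (-δ) g|) := by
  have hN : 0 < δ * (n : ℝ) ^ d := by positivity
  set a := |slopeError β h q δ g| + |slopeError β h q (-δ) g| with ha
  have h1 : Real.exp (∑ σ, gibbsWeight β h g σ * (δ * (n : ℝ) ^ d * |fieldDensity g σ - q|))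
      ≤ ∑ σ, gibbsWeight β h g σ * Real.exp (δ * (n : ℝ) ^ d * |fieldDensity g σ - q|) := by
    have := convexOn_exp.map_sum_le (t := Finset.univ) (w := fun σ => gibbsWeight β h g σ)
      (p := fun σ => δ * (n : ℝ) ^ d * |fieldDensity g σ - q|)
      (fun σ _ => (gibbsWeight_pos β h g σ).le) (sum_gibbsWeight β h g) fun _ _ => Set.mem_univ _
    simpa using this
  have h2 : ∑ σ, gibbsWeight β h g σ * Real.exp (δ * (n : ℝ) ^ d * |fieldDensity g σ - q|)
      ≤ Real.exp (δ * (n : ℝ) ^ d * slopeError β h q δ g)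
        + Real.exp (-δ * (n : ℝ) ^ d * slopeError β h q (-δ) g) := by
    rw [← sum_gibbsWeight_mul_exp β h hn g q hδ.ne',
      ← sum_gibbsWeight_mul_exp β h hn g q (neg_ne_zero.2 hδ.ne'), ← Finset.sum_add_distrib]
    refine Finset.sum_le_sum fun σ _ => ?_
    rw [← mul_add]
    refine mul_le_mul_of_nonneg_left ?_ (gibbsWeight_pos β h g σ).le
    rcases abs_cases (fieldDensity g σ - q) with ⟨hc, _⟩ | ⟨hc, _⟩
    · rw [hc, ← mul_assoc]
      linarith [Real.exp_pos (-δ * ((n : ℝ) ^ d * (fieldDensity g σ - q)))]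
    · rw [hc, show δ * (n : ℝ) ^ d * -(fieldDensity g σ - q)
        = -δ * ((n : ℝ) ^ d * (fieldDensity g σ - q)) by ring]
      linarith [Real.exp_pos (δ * ((n : ℝ) ^ d * (fieldDensity g σ - q)))]
  have h3 : Real.exp (δ * (n : ℝ) ^ d * slopeError β h q δ g) ≤ Real.exp (δ * (n : ℝ) ^ d * a) := by
    refine Real.exp_le_exp.2 (mul_le_mul_of_nonneg_left ?_ hN.le)
    linarith [le_abs_self (slopeError β h q δ g), abs_nonneg (slopeError β h q (-δ) g)]
  have h4 : Real.exp (-δ * (n : ℝ) ^ d * slopeError β h q (-δ) g)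
      ≤ Real.exp (δ * (n : ℝ) ^ d * a) := by
    rw [show -δ * (n : ℝ) ^ d * slopeError β h q (-δ) g
      = δ * (n : ℝ) ^ d * -slopeError β h q (-δ) g by ring]
    refine Real.exp_le_exp.2 (mul_le_mul_of_nonneg_left ?_ hN.le)
    linarith [neg_abs_le (slopeError β h q (-δ) g), abs_nonneg (slopeError β h q δ g)]
  have h5 : Real.exp (∑ σ, gibbsWeight β h g σ * (δ * (n : ℝ) ^ d * |fieldDensity g σ - q|))
      ≤ Real.exp (Real.log 2 + δ * (n : ℝ) ^ d * a) := by
    rw [Real.exp_add, Real.exp_log two_pos]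
    linarith
  have h6 := Real.exp_le_exp.1 h5
  have h7 : ∑ σ, gibbsWeight β h g σ * (δ * (n : ℝ) ^ d * |fieldDensity g σ - q|)
      = δ * (n : ℝ) ^ d * ∑ σ, gibbsWeight β h g σ * |fieldDensity g σ - q| := by
    rw [Finset.mul_sum]
    exact Finset.sum_congr rfl fun σ _ => by ring
  rw [h7] at h6
  rw [div_add' _ _ _ hN.ne', le_div_iff₀ hN]
  linarith

theorem integrable_slopeError (q t : ℝ) :
    Integrable (fun g => slopeError β h q t g) (disorderLaw d n) :=
  (((integrable_freeEnergyDensity d n β (h + t)).sub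
    (integrable_freeEnergyDensity d n β h)).const_mul _).sub (integrable_const q)

/-- This separates the disorder fluctuations of `ψ_n` at the two fields from the deterministic error
of the quotient of `p_n`. -/
theorem integral_abs_slopeError_le (q t : ℝ) :
    ∫ g, |slopeError β h q t g| ∂(disorderLaw d n)
      ≤ |t⁻¹| * (∫ g, |freeEnergyDensity β (h + t) g - meanFreeEnergy d n β (h + t)|
            ∂(disorderLaw d n)
          + ∫ g, |freeEnergyDensity β h g - meanFreeEnergy d n β h| ∂(disorderLaw d n))
        + |t⁻¹ * (meanFreeEnergy d n β (h + t) - meanFreeEnergy d n β h) - q| := by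
  have hi : ∀ u, Integrable (fun g => |freeEnergyDensity β u g - meanFreeEnergy d n β u|)
      (disorderLaw d n) := fun u =>
    ((integrable_freeEnergyDensity d n β u).sub (integrable_const _)).abs
  rw [← integral_add (hi _) (hi _), ← integral_const_mul]
  have hi2 : Integrable (fun g => |t⁻¹| *
      (|freeEnergyDensity β (h + t) g - meanFreeEnergy d n β (h + t)|
        + |freeEnergyDensity β h g - meanFreeEnergy d n β h|)) (disorderLaw d n) :=
    ((hi (h + t)).add (hi h)).const_mul |t⁻¹|
  set c := |t⁻¹ * (meanFreeEnergy d n β (h + t) - meanFreeEnergy d n β h) - q| with hc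
  have hcc : c = ∫ _g, c ∂(disorderLaw d n) := by simp
  rw [hcc, ← integral_add hi2 (integrable_const c)]
  refine integral_mono (integrable_slopeError β h q t).abs (hi2.add (integrable_const c))
    fun g => ?_
  have e : slopeError β h q t g
      = t⁻¹ * ((freeEnergyDensity β (h + t) g - meanFreeEnergy d n β (h + t))
          - (freeEnergyDensity β h g - meanFreeEnergy d n β h))
        + (t⁻¹ * (meanFreeEnergy d n β (h + t) - meanFreeEnergy d n β h) - q) := by
    unfold slopeError
    ring
  rw [e]
  refine (abs_add_le _ _).trans (add_le_add ?_ le_rfl)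
  rw [abs_mul]
  exact mul_le_mul_of_nonneg_left (abs_sub _ _) (abs_nonneg _)

theorem continuous_sum_gibbsWeight_mul_abs (q : ℝ) :
    Continuous fun g : Disorder d n => ∑ σ, gibbsWeight β h g σ * |fieldDensity g σ - q| :=
  continuous_finsetSum _ fun σ _ => (continuous_gibbsWeight β h σ).mul
    ((continuous_fieldDensity σ).sub continuous_const).abs

theorem sum_gibbsWeight_mul_abs_nonneg (q : ℝ) (g : Disorder d n) :
    0 ≤ ∑ σ, gibbsWeight β h g σ * |fieldDensity g σ - q| :=
  Finset.sum_nonneg fun σ _ => mul_nonneg (gibbsWeight_pos β h g σ).le (abs_nonneg _)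

theorem integrable_sum_gibbsWeight_mul_abs (hn : 0 < n) (q : ℝ) :
    Integrable (fun g => ∑ σ, gibbsWeight β h g σ * |fieldDensity g σ - q|) (disorderLaw d n) := by
  -- Any fixed `δ` dominates; `δ = 1` is chosen.
  refine Integrable.mono' ((integrable_const (Real.log 2 / (1 * (n : ℝ) ^ d))).add
    ((integrable_slopeError β h q 1).abs.add (integrable_slopeError β h q (-1)).abs))
    (continuous_sum_gibbsWeight_mul_abs β h q).aestronglyMeasurable (ae_of_all _ fun g => ?_)
  rw [Real.norm_eq_abs, abs_of_nonneg (sum_gibbsWeight_mul_abs_nonneg β h q g)]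
  exact sum_gibbsWeight_mul_abs_le β h hn g q one_pos

/-- The field energy concentrates, under the quenched measure, at the derivative of the limiting
free energy. -/
theorem tendsto_integral_sum_gibbsWeight_mul_abs (hd : 1 ≤ d) {q : ℝ}
    (hq : HasDerivAt (fun t => limitFreeEnergy d β t) q h) :
    Tendsto (fun n : ℕ => ∫ g, ∑ σ, gibbsWeight β h g σ * |fieldDensity g σ - q|
      ∂(disorderLaw d n)) atTop (nhds 0) := by
  rw [Metric.tendsto_atTop']
  intro ε hε
  have hs := hq.tendsto_slope_zero
  rw [Metric.tendsto_nhdsWithin_nhds] at hs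
  -- The quotients of the limit at `δ` and `-δ` together cost less than `ε / 2`. Since `δ` is fixed
  -- before `n → ∞`, all other terms tend to zero.
  obtain ⟨r, hr, hslope⟩ := hs (ε / 4) (by positivity)
  set δ := r / 2 with hδdef
  have hδ : 0 < δ := by positivity
  have hsl : ∀ t, t ≠ 0 → |t| = δ →
      |t⁻¹ * (limitFreeEnergy d β (h + t) - limitFreeEnergy d β h) - q| < ε / 4 := by
    intro t ht htd
    have := hslope (x := t) ht (by rw [Real.dist_eq, sub_zero, htd]; linarith)
    simpa [Real.dist_eq] using this
  have hterm : ∀ t, Tendsto (fun n : ℕ =>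
      |t⁻¹| * (∫ g, |freeEnergyDensity β (h + t) g - meanFreeEnergy d n β (h + t)|
            ∂(disorderLaw d n)
          + ∫ g, |freeEnergyDensity β h g - meanFreeEnergy d n β h| ∂(disorderLaw d n))
        + |t⁻¹ * (meanFreeEnergy d n β (h + t) - meanFreeEnergy d n β h) - q|) atTop
      (nhds (|t⁻¹| * (0 + 0)
        + |t⁻¹ * (limitFreeEnergy d β (h + t) - limitFreeEnergy d β h) - q|)) := fun t =>
    (((tendsto_integral_abs_freeEnergyDensity_sub d hd β (h + t)).add
      (tendsto_integral_abs_freeEnergyDensity_sub d hd β h)).const_mul _).add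
      ((((tendsto_meanFreeEnergy d hd β (h + t)).sub (tendsto_meanFreeEnergy d hd β h)).const_mul
        _).sub_const q).abs
  have hlog : Tendsto (fun n : ℕ => Real.log 2 / (δ * (n : ℝ) ^ d)) atTop (nhds 0) := by
    refine Tendsto.div_atTop tendsto_const_nhds (Tendsto.const_mul_atTop hδ ?_)
    exact (tendsto_pow_atTop (by omega)).comp tendsto_natCast_atTop_atTop
  have hev := (hlog.add ((hterm δ).add (hterm (-δ)))).eventually_lt_const (u := ε) (by
    have h1 := hsl δ hδ.ne' (abs_of_pos hδ)
    have h2 := hsl (-δ) (neg_ne_zero.2 hδ.ne') (by rw [abs_neg, abs_of_pos hδ])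
    linarith)
  obtain ⟨N, hN⟩ := eventually_atTop.1 hev
  refine ⟨max N 1, fun n hn => ?_⟩
  have hn0 : 0 < n := by omega
  have hn1 := hN n (by omega)
  have h0 : 0 ≤ ∫ g, ∑ σ, gibbsWeight β h g σ * |fieldDensity g σ - q| ∂(disorderLaw d n) :=
    integral_nonneg fun g => sum_gibbsWeight_mul_abs_nonneg β h q g
  rw [Real.dist_eq, sub_zero, abs_of_nonneg h0]
  have hi1 := (integrable_slopeError (d := d) (n := n) β h q δ).abs
  have hi2 := (integrable_slopeError (d := d) (n := n) β h q (-δ)).abs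
  have hle := integral_mono (integrable_sum_gibbsWeight_mul_abs (d := d) β h hn0 q)
    ((integrable_const (Real.log 2 / (δ * (n : ℝ) ^ d))).add (hi1.add hi2))
    fun g => sum_gibbsWeight_mul_abs_le β h hn0 g q hδ
  have hi3 : Integrable (fun g => |slopeError β h q δ g| + |slopeError β h q (-δ) g|)
      (disorderLaw d n) := hi1.add hi2
  simp only [Pi.add_apply] at hle
  rw [integral_add (integrable_const _) hi3, integral_add hi1 hi2, integral_const,
    probReal_univ, one_smul] at hle
  linarith [integral_abs_slopeError_le (d := d) (n := n) β h q δ,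
    integral_abs_slopeError_le (d := d) (n := n) β h q (-δ)]

theorem abs_integral_gibbsAvg_mul_fieldDensity_sub_le {m : ℕ} (hn : 0 < n) (q : ℝ)
    {F : (Fin m → Config d n) → ℝ} (hF : ∀ s, |F s| ≤ 1) (i₀ : Fin m) :
    |∫ g, gibbsAvg β h g (fun s => F s * fieldDensity g (s i₀)) ∂(disorderLaw d n)
        - q * quenchedAvg β h F|
      ≤ ∫ g, ∑ σ, gibbsWeight β h g σ * |fieldDensity g σ - q| ∂(disorderLaw d n) := by
  unfold quenchedAvg
  rw [← integral_const_mul, ← integral_sub (integrable_gibbsAvg_mul_fieldDensity β h F i₀)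
    ((integrable_gibbsAvg β h F).const_mul q)]
  rw [← Real.norm_eq_abs]
  refine norm_integral_le_of_norm_le (integrable_sum_gibbsWeight_mul_abs β h hn q)
    (ae_of_all _ fun g => ?_)
  rw [Real.norm_eq_abs, ← gibbsAvg_const_mul, ← gibbsAvg_sub,
    ← gibbsAvg_single β h g i₀ fun σ => |fieldDensity g σ - q|]
  refine abs_gibbsAvg_le β h g fun s => ?_
  rw [show F s * fieldDensity g (s i₀) - q * F s = F s * (fieldDensity g (s i₀) - q) by ring,
    abs_mul]
  exact mul_le_of_le_one_left (abs_nonneg _) (hF s)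

end Concentration

/-! ### Elimination of the limiting field density -/

theorem sum_castSucc_eq_add_sum_Ioo {k : ℕ} (hk : 0 < k) (F : Fin (k + 1) → ℝ) :
    ∑ i : Fin k, F i.castSucc = F 0 + ∑ i ∈ Finset.Ioo (0 : Fin (k + 1)) (Fin.last k), F i := by
  have h1 := Fin.sum_univ_castSucc F
  have h2 : (Finset.univ : Finset (Fin (k + 1)))
      = insert 0 (insert (Fin.last k) (Finset.Ioo 0 (Fin.last k))) := by
    ext i
    simp only [Finset.mem_univ, Finset.mem_insert, Finset.mem_Ioo, true_iff, Fin.ext_iff,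
      Fin.lt_def, Fin.val_zero, Fin.val_last]
    omega
  rw [h2, Finset.sum_insert, Finset.sum_insert] at h1
  · linarith
  · simp
  · simp [Fin.ext_iff, hk.ne]

end RFIM

theorem lemma2p9 (d : ℕ) (hd : 1 ≤ d) (β h : ℝ) (hβ : 0 < β) (hh : 0 < h)
    (hA : (β, h) ∉ RFIM.exceptionalSet d) (k : ℕ) (hk : 2 ≤ k)
    (f : (Fin k → Fin k → ℝ) → ℝ)
    (hf : ∀ R : Fin k → Fin k → ℝ,
      (∀ i j, R i j ∈ Set.Icc (-1 : ℝ) 1) → f R ∈ Set.Icc (-1 : ℝ) 1) :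
    Filter.Tendsto
      (fun n : ℕ =>
        RFIM.quenchedAvg β h (fun s : Fin (k + 1) → RFIM.Config d n =>
            f (RFIM.overlaps s) * RFIM.overlap (s 0) (s (Fin.last k)))
          - (1 / (k : ℝ))
            * RFIM.quenchedAvg β h (fun s : Fin (k + 1) → RFIM.Config d n =>
                f (RFIM.overlaps s))
            * RFIM.quenchedAvg β h (fun s : Fin (k + 1) → RFIM.Config d n =>
                RFIM.overlap (s 0) (s 1))
          - (1 / (k : ℝ)) * ∑ i ∈ Finset.Ioo (0 : Fin (k + 1)) (Fin.last k),
              RFIM.quenchedAvg β h (fun s : Fin (k + 1) → RFIM.Config d n =>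
                f (RFIM.overlaps s) * RFIM.overlap (s 0) (s i)))
      Filter.atTop (nhds 0) := by
  have hdiff : DifferentiableAt ℝ (fun t => RFIM.limitFreeEnergy d β t) h := by
    by_contra hnd
    exact hA ⟨hβ, hh, hnd⟩
  have hq := hdiff.hasDerivAt
  set q := deriv (fun t => RFIM.limitFreeEnergy d β t) h
  have hlim := RFIM.tendsto_integral_sum_gibbsWeight_mul_abs β h hd hq
  have hk0 : (0 : ℝ) < k := by exact_mod_cast (by omega : 0 < k)
  -- Two concentration errors, one for `f` and one for the constant `1`, enter with the prefactor `1
  -- / (h * k)`.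
  have hbound := hlim.const_mul (2 / (h * k))
  rw [mul_zero] at hbound
  refine squeeze_zero_norm' ?_ hbound
  filter_upwards [Filter.eventually_gt_atTop 0] with n hn
  set err := ∫ g, ∑ σ, RFIM.gibbsWeight β h g σ * |RFIM.fieldDensity g σ - q|
    ∂(RFIM.disorderLaw d n)
  let F : (Fin k → RFIM.Config d n) → ℝ := fun s => f fun i j => RFIM.overlap (s i) (s j)
  have hF : ∀ s, |F s| ≤ 1 := fun s =>
    abs_le.2 (hf _ fun i j => abs_le.1 (RFIM.abs_overlap_le_one (s i) (s j)))
  let i₀ : Fin k := ⟨0, by omega⟩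
  have hi₀ : i₀.castSucc = 0 := rfl
  have hfF := RFIM.abs_integral_gibbsAvg_mul_fieldDensity_sub_le β h hn q hF i₀
  -- The constant function with one replica: after integration by parts this says that `h * (1 -
  -- 𝔼⟨R_{1,2}⟩)` is within `err` of `q`.
  have hf1 := RFIM.abs_integral_gibbsAvg_mul_fieldDensity_sub_le β h hn q
    (F := fun _ : Fin 1 → RFIM.Config d n => (1 : ℝ)) (fun _ => by simp) 0
  -- The term `i = 0` is split off because its self-overlap is `1`, leaving `𝔼⟨f⟩`; the others form
  -- the sum over `Finset.Ioo`.
  rw [RFIM.integral_gibbsAvg_mul_fieldDensity, hi₀,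
    RFIM.sum_castSucc_eq_add_sum_Ioo (by omega) fun i =>
      RFIM.quenchedAvg β h fun s : Fin (k + 1) → RFIM.Config d n =>
        F (fun i => s i.castSucc) * RFIM.overlap (s 0) (s i), ← RFIM.quenchedAvg_init β h F] at hfF
  rw [RFIM.integral_gibbsAvg_mul_fieldDensity, RFIM.quenchedAvg_const] at hf1
  simp only [RFIM.overlap_self hn, mul_one, one_mul, Finset.univ_unique, Finset.sum_singleton,
    Fin.default_eq_zero, RFIM.quenchedAvg_const, Nat.cast_one] at hf1 hfF
  have h01 : (0 : Fin (k + 1)) ≠ 1 := by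
    rw [Ne, Fin.ext_iff, Fin.val_one', Fin.val_zero, Nat.mod_eq_of_lt (by omega)]
    omega
  rw [RFIM.quenchedAvg_overlap β h (by decide : (0 : Fin 1).castSucc ≠ Fin.last 1) h01] at hf1
  change |h * (RFIM.quenchedAvg β h (fun s : Fin (k + 1) → RFIM.Config d n => f (RFIM.overlaps s))
    + ∑ i ∈ Finset.Ioo (0 : Fin (k + 1)) (Fin.last k),
      RFIM.quenchedAvg β h (fun s : Fin (k + 1) → RFIM.Config d n =>
        f (RFIM.overlaps s) * RFIM.overlap (s 0) (s i))
    - k * RFIM.quenchedAvg β h (fun s : Fin (k + 1) → RFIM.Config d n =>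
        f (RFIM.overlaps s) * RFIM.overlap (s 0) (s (Fin.last k))))
    - q * RFIM.quenchedAvg β h (fun s : Fin (k + 1) → RFIM.Config d n => f (RFIM.overlaps s))|
    ≤ err at hfF
  have hAle : |RFIM.quenchedAvg β h
      (fun s : Fin (k + 1) → RFIM.Config d n => f (RFIM.overlaps s))| ≤ 1 :=
    RFIM.abs_quenchedAvg_le β h fun s => hF fun i => s i.castSucc
  generalize RFIM.quenchedAvg β h
    (fun s : Fin (k + 1) → RFIM.Config d n => f (RFIM.overlaps s)) = a at *
  generalize RFIM.quenchedAvg β h (fun s : Fin (k + 1) → RFIM.Config d n =>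
    RFIM.overlap (s 0) (s 1)) = r at *
  generalize RFIM.quenchedAvg β h (fun s : Fin (k + 1) → RFIM.Config d n =>
        f (RFIM.overlaps s) * RFIM.overlap (s 0) (s (Fin.last k))) = t at *
  generalize ∑ i ∈ Finset.Ioo (0 : Fin (k + 1)) (Fin.last k),
      RFIM.quenchedAvg β h (fun s : Fin (k + 1) → RFIM.Config d n =>
        f (RFIM.overlaps s) * RFIM.overlap (s 0) (s i)) = S at *
  -- Subtracting `a` times the one-replica identity cancels `q`.
  have e : t - 1 / (k : ℝ) * a * r - 1 / (k : ℝ) * S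
      = -((h * (a + S - k * t) - q * a) - a * (h * (1 - r) - q)) / (h * k) := by
    field_simp
    ring
  have hhk : 0 < h * k := by positivity
  have hprod : |a * (h * (1 - r) - q)| ≤ err := by
    rw [abs_mul]
    exact (mul_le_of_le_one_left (abs_nonneg _) hAle).trans hf1
  rw [e, Real.norm_eq_abs, abs_div, abs_neg, abs_of_pos hhk, div_mul_eq_mul_div]
  gcongr
  exact (abs_sub _ _).trans (by linarith)
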